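/- Notation. $\mathbb D$ is the open unit disk, $\mathbb T$ the unit circle, $M_{z_1},M_{z_2}$ are multiplication by the coordinates on the Hardy space $H^2(\mathbb D^2)$, and $\mathcal H(K)$ is the reproducing kernel Hilbert space with kernel $K$. Let $m\ge 0$. For $1\le i\le m$ let $p_i(z)=a_i+b_iz_1+c_iz_2+d_iz_1z_2$ be a polynomial without zeros in $\mathbb D^2$ that has no common factor with $\tilde p_i(z)=\bar a_iz_1z_2+\bar b_iz_2+\bar c_iz_1+\bar d_i$, so that $\theta_i=\tilde p_i/p_i$ is a rational inner function of degree $(1,1)$. Assume that $p_i(\tau_i)=0$ for some $\tau_i=(\tau_{1,i},\tau_{2,i})\in\mathbb T^2$, and let $\lambda_i\in\mathbb C$ satisfy $\lambda_i^2=\bar a_ic_i-d_i\bar b_i$. Put $$\Theta=\prod_{i=1}^m\theta_i,\qquad \mathcal K_\Theta=H^2(\mathbb D^2)\ominus\Theta H^2(\mathbb D^2),\qquad f_i(z)=\frac{\lambda_i(z_2-\tau_{2,i})}{p_i(z)},$$ $$\mathcal S_{2,\theta_i}=\mathcal H\!\left(\frac{f_i(z)\overline{f_i(w)}}{1-z_2\bar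 w_2}\right),\qquad \mathcal S_2=\bigoplus_{i=1}^m\Big(\prod_{k=1}^{i-1}\theta_k\Big)\mathcal S_{2,\theta_i},\qquad e_i=\Big(\prod_{k=1}^{i-1}\theta_k\Big)f_i .$$ Then each $\mathcal S_{2,\theta_i}$ is isometrically contained in $H^2(\mathbb D^2)$, the summands of $\mathcal S_2$ are pairwise orthogonal, $\mathcal S_2$ is a closed $M_{z_2}$-invariant subspace, and $\mathcal K_\Theta=\mathcal S_1\oplus\mathcal S_2$ for a closed $M_{z_1}$-invariant subspace $\mathcal S_1$. The functions $e_1,\dots,e_m$ form an orthonormal basis of $\mathcal S_2\ominus z_2\mathcal S_2$, and $\mathcal U(g_1,\dots,g_m)(z)=\sum_{i=1}^m e_i(z)g_i(z_2)$ defines a unitary operator $\mathcal U:H^2(\mathbb D)^m\to\mathcal S_2$. There is a unique matrix $H=(h_{ij})$ with entries in $H^2(\mathbb D)$ such that $(M_{z_1}^*e_j)(z)=\sum_{i=1}^m e_i(z)h_{ij}(z_2)$ for $j=1,\dots,m$. The symbol $M_\Theta$, which equals $H^*$ on $\mathbb D$, is the unique $m\times m$ matrix-valued function on $\overline{\mathbb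 D}$ with entries that are rational functions of $\bar z_2$ and continuous on $\overline{\mathbb D}$ such that $$S^1_\Theta:=P_{\mathcal S_2}P_{\mathcal K_\Theta}M_{z_1}|_{\mathcal S_2}=\mathcal U\,T_{M_\Theta}\,\mathcal U^*,$$ where $T_F\vec g=P_{H^2(\mathbb D)^m}(F\vec g)$ is the Toeplitz operator on $H^2(\mathbb D)^m$ with symbol $F|_{\mathbb T}$. It is given, for $z_2\in\overline{\mathbb D}$, by $$M_\Theta(z_2)_{ji}=\begin{cases}\overline{\lambda_j\,\dfrac{z_2-\tau_{2,j}}{a_j+c_jz_2}\;\lambda_i\,\dfrac{z_2-\tau_{2,i}}{a_i+c_iz_2}\;\displaystyle\prod_{k=i+1}^{j-1}\frac{\bar b_kz_2+\bar d_k}{a_k+c_kz_2}} & \text{if } j>i,\\[3ex] \overline{-\dfrac{b_i+d_iz_2}{a_i+c_iz_2}} & \text{if } j=i,\\[2ex] 0 & \text{if } j<i.\end{cases}$$ -/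

import Mathlib

open scoped ComplexConjugate ENNReal InnerProductSpace

noncomputable section

namespace BidiskModel

/-! ### Hardy spaces of the disk and the bidisk -/

/-- `H²(𝔻)`: the power series `∑ fₙ zⁿ` with square-summable coefficients, with the `ℓ²` inner
product of the coefficients. -/
abbrev H2Disk : Type := lp (fun _ : ℕ => ℂ) 2

/-- `H²(𝔻²)`: the power series `∑ F₍ⱼ,ₖ₎ z₁ʲ z₂ᵏ` with square-summable coefficients, with the `ℓ²`
inner product of the coefficients. -/
abbrev H2Bidisk : Type := lp (fun _ : ℕ × ℕ => ℂ) 2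

/-- The open unit disk. -/
def disk : Set ℂ := {z | ‖z‖ < 1}

/-- The open bidisk `𝔻²`. -/
def bidisk : Set (ℂ × ℂ) := {z | ‖z.1‖ < 1 ∧ ‖z.2‖ < 1}

/-- The value at `z ∈ 𝔻` of an element of `H²(𝔻)`. -/
def eval₁ (f : H2Disk) (z : ℂ) : ℂ := ∑' n : ℕ, f n * z ^ n

/-- The value at `z ∈ 𝔻²` of an element of `H²(𝔻²)`. -/
def eval₂ (F : H2Bidisk) (z : ℂ × ℂ) : ℂ := ∑' n : ℕ × ℕ, F n * (z.1 ^ n.1 * z.2 ^ n.2)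

theorem summable_eval₂ (F : H2Bidisk) {z : ℂ × ℂ} (hz : z ∈ bidisk) :
    Summable fun n : ℕ × ℕ => F n * (z.1 ^ n.1 * z.2 ^ n.2) := by
  have h : Summable fun n : ℕ × ℕ => ‖z.1‖ ^ n.1 * ‖z.2‖ ^ n.2 :=
    (summable_geometric_of_lt_one (norm_nonneg _) hz.1).mul_of_nonneg
      (summable_geometric_of_lt_one (norm_nonneg _) hz.2)
      (fun _ => by positivity) (fun _ => by positivity)
  refine Summable.of_norm_bounded (h.mul_left ‖F‖) fun n => ?_
  rw [norm_mul, norm_mul, norm_pow, norm_pow]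
  gcongr
  exact lp.norm_apply_le_norm (by norm_num) F n

theorem eval₂_zero (z : ℂ × ℂ) : eval₂ 0 z = 0 := by simp [eval₂]

theorem eval₂_add (F G : H2Bidisk) {z : ℂ × ℂ} (hz : z ∈ bidisk) :
    eval₂ (F + G) z = eval₂ F z + eval₂ G z := by
  simp only [eval₂, lp.coeFn_add, Pi.add_apply, add_mul]
  exact (summable_eval₂ F hz).tsum_add (summable_eval₂ G hz)

theorem eval₂_smul (r : ℂ) (F : H2Bidisk) (z : ℂ × ℂ) :
    eval₂ (r • F) z = r * eval₂ F z := by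
  simp only [eval₂, lp.coeFn_smul, Pi.smul_apply, smul_eq_mul, mul_assoc, tsum_mul_left]

/-- The orthonormal basis of monomials `z₁ʲ z₂ᵏ` of `H²(𝔻²)`. -/
def monomialBasis : HilbertBasis (ℕ × ℕ) ℂ H2Bidisk :=
  HilbertBasis.ofRepr (LinearIsometryEquiv.refl ℂ H2Bidisk)

/-- The isometry of `H²(𝔻²)` that sends the monomial with exponent `n` to that with exponent
`σ n`. -/
def monomialIsometry (σ : ℕ × ℕ → ℕ × ℕ) (hσ : Function.Injective σ) : H2Bidisk →ₗᵢ[ℂ] H2Bidisk :=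
  (monomialBasis.orthonormal.comp σ hσ).orthogonalFamily.linearIsometry

/-- `M_{z₁}`: multiplication by `z₁` on `H²(𝔻²)`, sending `z₁ʲ z₂ᵏ` to `z₁ʲ⁺¹ z₂ᵏ`. -/
def mulZ₁ : H2Bidisk →L[ℂ] H2Bidisk :=
  (monomialIsometry (fun n => (n.1 + 1, n.2))
    (fun n k h => by simpa [Prod.ext_iff] using h)).toContinuousLinearMap

/-- `M_{z₂}`: multiplication by `z₂` on `H²(𝔻²)`, sending `z₁ʲ z₂ᵏ` to `z₁ʲ z₂ᵏ⁺¹`. -/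
def mulZ₂ : H2Bidisk →L[ℂ] H2Bidisk :=
  (monomialIsometry (fun n => (n.1, n.2 + 1))
    (fun n k h => by simpa [Prod.ext_iff] using h)).toContinuousLinearMap

/-! ### Subspaces of `H²(𝔻²)` -/

/-- `φ S`: the products in `H²(𝔻²)` of the function `φ` on the bidisk with members of `S`. -/
def mulImage (φ : ℂ × ℂ → ℂ) (S : Submodule ℂ H2Bidisk) : Submodule ℂ H2Bidisk where
  carrier := {G | ∃ F ∈ S, ∀ z ∈ bidisk, eval₂ G z = φ z * eval₂ F z}
  zero_mem' := ⟨0, S.zero_mem, fun z _ => by simp [eval₂_zero]⟩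
  add_mem' := by
    rintro G G' ⟨F, hF, h⟩ ⟨F', hF', h'⟩
    refine ⟨F + F', S.add_mem hF hF', fun z hz => ?_⟩
    rw [eval₂_add _ _ hz, eval₂_add _ _ hz, h z hz, h' z hz, mul_add]
  smul_mem' := by
    rintro r G ⟨F, hF, h⟩
    refine ⟨r • F, S.smul_mem r hF, fun z hz => ?_⟩
    rw [eval₂_smul, eval₂_smul, h z hz]
    ring

/-- The model space `K_Θ = H²(𝔻²) ⊖ Θ H²(𝔻²)`. -/
def modelSpace (Θ : ℂ × ℂ → ℂ) : Submodule ℂ H2Bidisk := (mulImage Θ ⊤)ᗮ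

instance (Θ : ℂ × ℂ → ℂ) : (modelSpace Θ).HasOrthogonalProjection := by
  have : CompleteSpace (modelSpace Θ) :=
    (Submodule.isClosed_orthogonal (mulImage Θ ⊤)).completeSpace_coe
  infer_instance

/-- The closed linear span in `H²(𝔻²)` of the kernel functions `K(·, w)`, `w ∈ 𝔻²`. -/
def kernelSpan (K : ℂ × ℂ → ℂ × ℂ → ℂ) : Submodule ℂ H2Bidisk :=
  (Submodule.span ℂ
    {F : H2Bidisk | ∃ w ∈ bidisk, ∀ z ∈ bidisk, eval₂ F z = K z w}).topologicalClosure

/-- The subspace `S` of `H²(𝔻²)`, with the inherited inner product, is the reproducing kernel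
Hilbert space `H(K)`. -/
def IsReproducingKernelSpace (S : Submodule ℂ H2Bidisk) (K : ℂ × ℂ → ℂ × ℂ → ℂ) : Prop :=
  IsClosed (S : Set H2Bidisk) ∧
    ∀ w ∈ bidisk, ∃ k ∈ S, (∀ z ∈ bidisk, eval₂ k z = K z w) ∧ ∀ F ∈ S, ⟪k, F⟫_ℂ = eval₂ F w

/-- `S ⊖ z₂ S`. -/
def wandering (S : Submodule ℂ H2Bidisk) : Submodule ℂ H2Bidisk :=
  S ⊓ (S.map (mulZ₂ : H2Bidisk →ₗ[ℂ] H2Bidisk))ᗮ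

/-- `S` is the `z₂`-invariant summand of a decomposition `K_Θ = S₁ ⊕ S` (orthogonal sum of
subspaces) with `S₁` invariant under `M_{z₁}` and `S` invariant under `M_{z₂}`. -/
def IsZ₂Summand (Θ : ℂ × ℂ → ℂ) (S : Submodule ℂ H2Bidisk) : Prop :=
  IsClosed (S : Set H2Bidisk) ∧ (∀ F ∈ S, mulZ₂ F ∈ S) ∧
    ∃ S₁ : Submodule ℂ H2Bidisk, IsClosed (S₁ : Set H2Bidisk) ∧ (∀ F ∈ S₁, mulZ₁ F ∈ S₁) ∧
      S₁ ⟂ S ∧ S₁ ⊔ S = modelSpace Θ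

/-- The compressed shift `S¹_Θ = P_S (P_Θ M_{z₁}) |_S` on `S`. -/
def compressedShift (Θ : ℂ × ℂ → ℂ) (S : Submodule ℂ H2Bidisk) [S.HasOrthogonalProjection] :
    S →L[ℂ] S :=
  S.orthogonalProjectionOnto ∘L (modelSpace Θ).starProjection ∘L mulZ₁ ∘L S.subtypeL

/-! ### Matrix-valued Toeplitz operators in the variable `z₂` -/

/-- `H²(𝔻)ᵐ`, the Hilbert space direct sum of `m` copies of `H²(𝔻)`. -/
abbrev H2DiskVec (m : ℕ) : Type := PiLp 2 (fun _ : Fin m => H2Disk)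

/-- `L²(𝕋)` for normalized Lebesgue measure; the circle is `ℝ/ℤ`, with `x` standing for
`AddCircle.toCircle x = exp (2πix)`. -/
abbrev L2Circle : Type := MeasureTheory.Lp ℂ 2 (AddCircle.haarAddCircle (T := (1 : ℝ)))

/-- `L^∞(𝕋)`. -/
abbrev LInftyCircle : Type := MeasureTheory.Lp ℂ ∞ (AddCircle.haarAddCircle (T := (1 : ℝ)))

/-- The isometric embedding `H²(𝔻) → L²(𝕋)`, `∑ fₙ zⁿ ↦ ∑ fₙ exp (2πinx)` (boundary values). -/
def boundary : H2Disk →L[ℂ] L2Circle :=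
  ((orthonormal_fourier (T := (1 : ℝ))).comp (fun n : ℕ => (n : ℤ))
    Nat.cast_injective).orthogonalFamily.linearIsometry.toContinuousLinearMap

/-- Multiplication by a function of `L^∞(𝕋)` on `L²(𝕋)`. -/
def mulLInfty (φ : LInftyCircle) : L2Circle →L[ℂ] L2Circle :=
  (ContinuousLinearMap.mul ℂ ℂ).holderL AddCircle.haarAddCircle ∞ 2 2 φ

/-- The scalar Toeplitz operator `f ↦ P_{H²} (φ f)` on `H²(𝔻)`; the adjoint of the isometric
embedding `H²(𝔻) → L²(𝕋)` is the orthogonal projection of `L²(𝕋)` onto `H²(𝔻)`. -/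
def toeplitzScalar (φ : LInftyCircle) : H2Disk →L[ℂ] H2Disk :=
  ContinuousLinearMap.adjoint boundary ∘L mulLInfty φ ∘L boundary

/-- The Toeplitz operator `T_F f = P (F f)` on `H²(𝔻)ᵐ` with bounded matrix-valued symbol `F`:
`(T_F f)ⱼ = ∑ᵢ P (Fⱼᵢ fᵢ)`. -/
def toeplitz {m : ℕ} (F : Matrix (Fin m) (Fin m) LInftyCircle) : H2DiskVec m →L[ℂ] H2DiskVec m :=
  (PiLp.continuousLinearEquiv 2 ℂ (fun _ : Fin m => H2Disk)).symm.toContinuousLinearMap ∘L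
    ContinuousLinearMap.pi fun j =>
      ∑ i : Fin m, toeplitzScalar (F j i) ∘L PiLp.proj 2 (fun _ : Fin m => H2Disk) i

/-- `M` has entries that are rational functions of `z̄` without poles on the closed unit disk (so
that they are continuous there). -/
def IsRationalInConj {m : ℕ} (M : ℂ → Matrix (Fin m) (Fin m) ℂ) : Prop :=
  ∀ j i, ∃ P Q : Polynomial ℂ, ∀ z : ℂ, ‖z‖ ≤ 1 →
    Q.eval (conj z) ≠ 0 ∧ M z j i = P.eval (conj z) / Q.eval (conj z)

/-- `M`, with entries rational in `z̄` and continuous on the closed disk, satisfies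
`S¹_Θ = U T_M U*` for the unitary `U : H²(𝔻)ᵐ → S`. -/
def IsShiftSymbol {m : ℕ} (Θ : ℂ × ℂ → ℂ) (S : Submodule ℂ H2Bidisk) [S.HasOrthogonalProjection]
    (U : H2DiskVec m ≃ₗᵢ[ℂ] S) (M : ℂ → Matrix (Fin m) (Fin m) ℂ) : Prop :=
  IsRationalInConj M ∧
    ∃ F : Matrix (Fin m) (Fin m) LInftyCircle,
      (∀ j i, F j i =ᵐ[AddCircle.haarAddCircle]
        fun x : AddCircle (1 : ℝ) => M (AddCircle.toCircle x : ℂ) j i) ∧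
      ∀ G : S, compressedShift Θ S G = U (toeplitz F (U.symm G))

/-- `H = (hᵢⱼ)`, with entries in `H²(𝔻)`, satisfies `M_{z₁}* eⱼ = ∑ᵢ eᵢ(z) hᵢⱼ(z₂)` for all `j`. -/
def IsBackwardShiftMatrix {m : ℕ} (e : Fin m → H2Bidisk) (H : Matrix (Fin m) (Fin m) H2Disk) :
    Prop :=
  ∀ j, ∀ z ∈ bidisk,
    eval₂ (ContinuousLinearMap.adjoint mulZ₁ (e j)) z = ∑ i, eval₂ (e i) z * eval₁ (H i j) z.2

/-! ### Rational inner functions of degree `(1,1)` -/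

/-- The polynomial `a + b z₁ + c z₂ + d z₁ z₂`, given by its coefficients. -/
structure BiAffine where
  a : ℂ
  b : ℂ
  c : ℂ
  d : ℂ

namespace BiAffine

/-- The value of `p` at `z`. -/
def eval (p : BiAffine) (z : ℂ × ℂ) : ℂ := p.a + p.b * z.1 + p.c * z.2 + p.d * (z.1 * z.2)

/-- `p̃(z) = z₁ z₂ conj (p (1/z̄₁, 1/z̄₂)) = d̄ + c̄ z₁ + b̄ z₂ + ā z₁ z₂`. -/
def tilde (p : BiAffine) : BiAffine := ⟨conj p.d, conj p.c, conj p.b, conj p.a⟩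

/-- `p` as an element of `ℂ[z₁, z₂]`. -/
def toMvPolynomial (p : BiAffine) : MvPolynomial (Fin 2) ℂ :=
  MvPolynomial.C p.a + MvPolynomial.C p.b * MvPolynomial.X 0 +
    MvPolynomial.C p.c * MvPolynomial.X 1 +
    MvPolynomial.C p.d * (MvPolynomial.X 0 * MvPolynomial.X 1)

/-- `p̃ / p` is a rational inner function of degree `(1,1)` in lowest terms: `p` has no zero on
`𝔻²`, and `p` and `p̃` have no common factor. (As `p(0) ≠ 0`, the coefficient of `z₁ z₂` in `p̃` is
not zero, so the degree is exactly `(1,1)`.) -/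
def IsInner (p : BiAffine) : Prop :=
  (∀ z ∈ bidisk, p.eval z ≠ 0) ∧ IsRelPrime p.toMvPolynomial p.tilde.toMvPolynomial

/-- `θ = p̃ / p`. -/
def inner (p : BiAffine) (z : ℂ × ℂ) : ℂ := p.tilde.eval z / p.eval z

/-- `f(z) = l (z₂ - t) / p(z)`. -/
def reproducing (p : BiAffine) (l t : ℂ) (z : ℂ × ℂ) : ℂ := l * (z.2 - t) / p.eval z

/-- The kernel `f(z) conj (f(w)) / (1 - z₂ w̄₂)` of the `z₂`-invariant summand of `K_θ`. -/
def kernel (p : BiAffine) (l t : ℂ) (z w : ℂ × ℂ) : ℂ :=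
  p.reproducing l t z * conj (p.reproducing l t w) / (1 - z.2 * conj w.2)

/-- The `z₂`-invariant summand `S_{2,θ} = H(f(z) conj (f(w)) / (1 - z₂ w̄₂))` of `K_θ`. -/
def S₂ (p : BiAffine) (l t : ℂ) : Submodule ℂ H2Bidisk := kernelSpan (p.kernel l t)

end BiAffine

variable {m : ℕ}

/-- `θ₁ ⋯ θ_{i-1}`. -/
def partialProduct (p : Fin m → BiAffine) (i : Fin m) (z : ℂ × ℂ) : ℂ :=
  ∏ k ∈ Finset.Iio i, (p k).inner z

/-- `Θ = θ₁ ⋯ θ_m`. -/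
def fullProduct (p : Fin m → BiAffine) (z : ℂ × ℂ) : ℂ := ∏ k, (p k).inner z

/-- The `i`-th summand `(θ₁ ⋯ θ_{i-1}) S_{2,θᵢ}` of `S₂`. -/
def summand (p : Fin m → BiAffine) (l t : Fin m → ℂ) (i : Fin m) : Submodule ℂ H2Bidisk :=
  mulImage (partialProduct p i) ((p i).S₂ (l i) (t i))

/-- `S₂ = ⨁ᵢ (θ₁ ⋯ θ_{i-1}) S_{2,θᵢ}` (Hilbert space sum). -/
def productS₂ (p : Fin m → BiAffine) (l t : Fin m → ℂ) : Submodule ℂ H2Bidisk :=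
  (⨆ i, summand p l t i).topologicalClosure

instance (p : Fin m → BiAffine) (l t : Fin m → ℂ) :
    (productS₂ p l t).HasOrthogonalProjection := by
  have : CompleteSpace (productS₂ p l t) :=
    (Submodule.isClosed_topologicalClosure (⨆ i, summand p l t i)).completeSpace_coe
  infer_instance

/-- The explicit lower triangular matrix-valued function; `j` is the row and `i` the column. -/
def explicitSymbol (p : Fin m → BiAffine) (l t : Fin m → ℂ) (z : ℂ) : Matrix (Fin m) (Fin m) ℂ :=
  Matrix.of fun j i =>
    if i < j then
      conj (l j * ((z - t j) / ((p j).a + (p j).c * z)) *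
        (l i * ((z - t i) / ((p i).a + (p i).c * z))) *
        ∏ k ∈ Finset.Ioo i j, (conj (p k).b * z + conj (p k).d) / ((p k).a + (p k).c * z))
    else if j = i then
      conj (-(((p i).b + (p i).d * z) / ((p i).a + (p i).c * z)))
    else 0

end BidiskModel

end

noncomputable section

namespace BidiskModel

open Filter Topology

/-! ### Coefficients -/

section Coefficients

variable {ι E : Type*} [NormedAddCommGroup E] [InnerProductSpace ℂ E] [CompleteSpace E]

/-! Write p = A + z₁B with A, B affine in z₂, and put ψ = -B/A, φ = f(0, ·), ζ = θ(0, ·). On the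
circle |A|² - |B|² is a nonnegative trigonometric polynomial of degree one that vanishes at t = τ₂,
so it equals |l|²|z₂ - t|² (`IsInner.regular`). Divided by |A|², this says |φ|² + |ψ|² = 1.

Two identities for division by z₁ drive the rest: f - φ = z₁ψf and θ - ζ = z₁φf (`reproducing_sub`,
`inner_sub`). The first gives fg = ∑ z₁ⁿψⁿφg, so multiplication by f is an isometry from H²(𝔻) into
H²(𝔻²); the norms telescope because ψⁿ → 0 strongly (`hasSum_norm_sq_pow`). Multiplication by θ is
an isometry because p̃ and p give vectors of equal norm when commuting isometries are substituted,
and pH² is dense (`norm_operator_tilde`, `denseRange_operator`). Since f H²(𝔻) is orthogonal to θH²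
(`inner_eq_zero`), the spaces eᵢH²(𝔻) are pairwise orthogonal, which makes U unitary.

As M_{z₁}*F = (F - F(0, ·))/z₁, telescoping a product of the θₖ yields M_{z₁}*eⱼ = ∑ eᵢhᵢⱼ with
explicit hᵢⱼ (`basisValue_sub`), and M_{z₁}*(ΘF) ∈ ΘH² + S₂ (`fullProduct_sub`). Hence S₂ and S₂ ⊕
ΘH² are M_{z₁}*-invariant. The complement of the second is S₁, and in the coordinates of U the
adjoint of the compressed shift is multiplication by H, so the shift itself is the Toeplitz operator
with symbol H*. Uniqueness holds because a Toeplitz operator determines its symbol almost everywhere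
on the circle, and a rational function of z̄ is determined by its values there. -/

theorem inner_linearIsometry {v : ι → E} (hv : Orthonormal ℂ v) (f : lp (fun _ : ι => ℂ) 2)
    (x : E) : HasSum (fun i => f i * ⟪x, v i⟫_ℂ) ⟪x, hv.orthogonalFamily.linearIsometry f⟫_ℂ := by
  have h := (innerSL ℂ x).hasSum (hv.orthogonalFamily.hasSum_linearIsometry f)
  simpa [LinearIsometry.toSpanSingleton_apply, inner_smul_right] using h

theorem inner_orthonormal_linearIsometry {v : ι → E} (hv : Orthonormal ℂ v)
    (f : lp (fun _ : ι => ℂ) 2) (i : ι) :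
    ⟪v i, hv.orthogonalFamily.linearIsometry f⟫_ℂ = f i := by
  classical
  refine (inner_linearIsometry hv f (v i)).unique ?_
  convert hasSum_ite_eq i (f i) using 2 with j
  rcases eq_or_ne j i with rfl | h
  · simp [hv.1 j, inner_self_eq_norm_sq_to_K]
  · simp [h, hv.2 h.symm]

theorem inner_linearIsometry_eq_zero {v : ι → E} (hv : Orthonormal ℂ v)
    (f : lp (fun _ : ι => ℂ) 2) {x : E} (hx : ∀ i, ⟪x, v i⟫_ℂ = 0) :
    ⟪x, hv.orthogonalFamily.linearIsometry f⟫_ℂ = 0 := by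
  refine (inner_linearIsometry hv f x).unique ?_
  simp [hx, hasSum_zero]

theorem linearIsometry_single [DecidableEq ι] {v : ι → E} (hv : Orthonormal ℂ v) (i : ι) :
    hv.orthogonalFamily.linearIsometry (lp.single 2 i (1 : ℂ)) = v i := by
  rw [hv.orthogonalFamily.linearIsometry_apply_single]
  simp [LinearIsometry.toSpanSingleton_apply]

end Coefficients

theorem inner_single_left {ι : Type*} [DecidableEq ι] (i : ι) (f : lp (fun _ : ι => ℂ) 2) :
    ⟪lp.single 2 i (1 : ℂ), f⟫_ℂ = f i := by
  rw [lp.inner_single_left]; simp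

theorem monomialBasis_apply (n : ℕ × ℕ) : monomialBasis n = lp.single 2 n (1 : ℂ) := by
  ext k
  have := monomialBasis.repr_self n
  rw [← this]; rfl

theorem monomialIsometry_apply (σ : ℕ × ℕ → ℕ × ℕ) (hσ : Function.Injective σ) (F : H2Bidisk)
    (n : ℕ × ℕ) : monomialIsometry σ hσ F (σ n) = F n := by
  have := inner_orthonormal_linearIsometry (monomialBasis.orthonormal.comp σ hσ) F n
  rw [Function.comp_apply, monomialBasis_apply, inner_single_left] at this
  exact this

theorem monomialIsometry_apply_of_notMem (σ : ℕ × ℕ → ℕ × ℕ) (hσ : Function.Injective σ)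
    (F : H2Bidisk) {n : ℕ × ℕ} (hn : ∀ k, σ k ≠ n) : monomialIsometry σ hσ F n = 0 := by
  have := inner_linearIsometry_eq_zero (monomialBasis.orthonormal.comp σ hσ) F
    (x := monomialBasis n) (fun k => monomialBasis.orthonormal.2 (hn k).symm)
  rw [monomialBasis_apply, inner_single_left] at this
  exact this

theorem monomialIsometry_single (σ : ℕ × ℕ → ℕ × ℕ) (hσ : Function.Injective σ) (n : ℕ × ℕ) :
    monomialIsometry σ hσ (lp.single 2 n (1 : ℂ)) = lp.single 2 (σ n) (1 : ℂ) := by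
  rw [← monomialBasis_apply (σ n)]
  exact linearIsometry_single (monomialBasis.orthonormal.comp σ hσ) n

@[simp] theorem norm_mulZ₁ (F : H2Bidisk) : ‖mulZ₁ F‖ = ‖F‖ := LinearIsometry.norm_map _ _

@[simp] theorem norm_mulZ₂ (F : H2Bidisk) : ‖mulZ₂ F‖ = ‖F‖ := LinearIsometry.norm_map _ _

theorem injective_fst_succ : Function.Injective fun n : ℕ × ℕ => (n.1 + 1, n.2) :=
  fun n k h => by simpa [Prod.ext_iff] using h

theorem injective_snd_succ : Function.Injective fun n : ℕ × ℕ => (n.1, n.2 + 1) :=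
  fun n k h => by simpa [Prod.ext_iff] using h

theorem mulZ₁_apply_succ (F : H2Bidisk) (j k : ℕ) : mulZ₁ F (j + 1, k) = F (j, k) :=
  monomialIsometry_apply _ injective_fst_succ F (j, k)

theorem mulZ₁_apply_zero (F : H2Bidisk) (k : ℕ) : mulZ₁ F (0, k) = 0 :=
  monomialIsometry_apply_of_notMem _ injective_fst_succ F (by simp)

theorem mulZ₂_apply_succ (F : H2Bidisk) (j k : ℕ) : mulZ₂ F (j, k + 1) = F (j, k) :=
  monomialIsometry_apply _ injective_snd_succ F (j, k)

theorem mulZ₂_apply_zero (F : H2Bidisk) (j : ℕ) : mulZ₂ F (j, 0) = 0 :=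
  monomialIsometry_apply_of_notMem _ injective_snd_succ F (by simp)

theorem adjoint_mulZ₁_apply (F : H2Bidisk) (j k : ℕ) :
    ContinuousLinearMap.adjoint mulZ₁ F (j, k) = F (j + 1, k) := by
  rw [← inner_single_left, ContinuousLinearMap.adjoint_inner_right]
  rw [show mulZ₁ (lp.single 2 (j, k) (1 : ℂ)) = lp.single 2 (j + 1, k) (1 : ℂ) from
    monomialIsometry_single _ injective_fst_succ (j, k), inner_single_left]

/-- The unilateral shift: multiplication by the coordinate on `H²(𝔻)`. -/
def shift : H2Disk →L[ℂ] H2Disk :=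
  ((((HilbertBasis.ofRepr (LinearIsometryEquiv.refl ℂ H2Disk)).orthonormal.comp Nat.succ
    Nat.succ_injective).orthogonalFamily.linearIsometry)).toContinuousLinearMap

@[simp] theorem norm_shift (f : H2Disk) : ‖shift f‖ = ‖f‖ := LinearIsometry.norm_map _ _

theorem diskBasis_apply (n : ℕ) :
    (HilbertBasis.ofRepr (LinearIsometryEquiv.refl ℂ H2Disk)) n = lp.single 2 n (1 : ℂ) := by
  ext k
  have := (HilbertBasis.ofRepr (LinearIsometryEquiv.refl ℂ H2Disk)).repr_self n
  rw [← this]; rfl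

theorem shift_apply_succ (f : H2Disk) (n : ℕ) : shift f (n + 1) = f n := by
  have := inner_orthonormal_linearIsometry
    ((HilbertBasis.ofRepr (LinearIsometryEquiv.refl ℂ H2Disk)).orthonormal.comp Nat.succ
      Nat.succ_injective) f n
  rw [Function.comp_apply, diskBasis_apply, inner_single_left] at this
  exact this

theorem shift_apply_zero (f : H2Disk) : shift f 0 = 0 := by
  have := inner_linearIsometry_eq_zero
    ((HilbertBasis.ofRepr (LinearIsometryEquiv.refl ℂ H2Disk)).orthonormal.comp Nat.succ
      Nat.succ_injective) f (x := lp.single 2 0 (1 : ℂ))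
    (fun k => by
      rw [Function.comp_apply, diskBasis_apply, inner_single_left]
      simp)
  rwa [inner_single_left] at this

/-! ### Point evaluations -/

theorem summable_eval₁ (f : H2Disk) {z : ℂ} (hz : z ∈ disk) :
    Summable fun n : ℕ => f n * z ^ n := by
  refine Summable.of_norm_bounded
    ((summable_geometric_of_lt_one (norm_nonneg _) hz).mul_left ‖f‖) fun n => ?_
  rw [norm_mul, norm_pow]
  gcongr
  exact lp.norm_apply_le_norm (by norm_num) f n

theorem eval₁_add (f g : H2Disk) {z : ℂ} (hz : z ∈ disk) :
    eval₁ (f + g) z = eval₁ f z + eval₁ g z := by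
  simp only [eval₁, lp.coeFn_add, Pi.add_apply, add_mul]
  exact (summable_eval₁ f hz).tsum_add (summable_eval₁ g hz)

theorem eval₁_smul (r : ℂ) (f : H2Disk) (z : ℂ) : eval₁ (r • f) z = r * eval₁ f z := by
  simp only [eval₁, lp.coeFn_smul, Pi.smul_apply, smul_eq_mul, mul_assoc, tsum_mul_left]

theorem eval₁_zero (z : ℂ) : eval₁ 0 z = 0 := by simp [eval₁]

theorem eval₁_sub (f g : H2Disk) {z : ℂ} (hz : z ∈ disk) :
    eval₁ (f - g) z = eval₁ f z - eval₁ g z := by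
  rw [sub_eq_add_neg, ← neg_one_smul ℂ g, eval₁_add _ _ hz, eval₁_smul]; ring

theorem eval₁_sum {ι : Type*} (s : Finset ι) (f : ι → H2Disk) {z : ℂ} (hz : z ∈ disk) :
    eval₁ (∑ i ∈ s, f i) z = ∑ i ∈ s, eval₁ (f i) z := by
  classical
  induction s using Finset.induction_on with
  | empty => simp [eval₁_zero]
  | insert i s hi ih => rw [Finset.sum_insert hi, Finset.sum_insert hi, eval₁_add _ _ hz, ih]

theorem eval₂_sub (F G : H2Bidisk) {z : ℂ × ℂ} (hz : z ∈ bidisk) :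
    eval₂ (F - G) z = eval₂ F z - eval₂ G z := by
  rw [sub_eq_add_neg, ← neg_one_smul ℂ G, eval₂_add _ _ hz, eval₂_smul]; ring

theorem eval₂_sum {ι : Type*} (s : Finset ι) (F : ι → H2Bidisk) {z : ℂ × ℂ} (hz : z ∈ bidisk) :
    eval₂ (∑ i ∈ s, F i) z = ∑ i ∈ s, eval₂ (F i) z := by
  classical
  induction s using Finset.induction_on with
  | empty => simp [eval₂_zero]
  | insert i s hi ih => rw [Finset.sum_insert hi, Finset.sum_insert hi, eval₂_add _ _ hz, ih]

/-- A power series that converges to zero on the disk has zero coefficients. -/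
theorem coeff_eq_zero_of_hasSum {a : ℕ → ℂ}
    (h : ∀ z ∈ disk, HasSum (fun n => a n * z ^ n) 0) (n : ℕ) : a n = 0 := by
  -- The series represents the zero function on the unit ball, so uniqueness of power series at 0
  -- applies.
  have hb : HasFPowerSeriesOnBall (fun _ : ℂ => (0 : ℂ)) (FormalMultilinearSeries.ofScalars ℂ a)
      0 1 := by
    refine ⟨?_, one_pos, fun {y} hy => ?_⟩
    · refine ENNReal.le_of_forall_nnreal_lt fun r hr => ?_
      have hr1 : (r : ℝ) < 1 := by exact_mod_cast hr
      refine FormalMultilinearSeries.le_radius_of_summable _ ?_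
      have : ((r : ℂ)) ∈ disk := by simpa [disk] using hr1
      refine (h _ this).summable.norm.congr fun n => ?_
      simp
    · have hy' : y ∈ disk := by
        rw [Metric.mem_eball, edist_zero_right, ← ofReal_norm, ENNReal.ofReal_lt_one] at hy
        exact hy
      simpa [FormalMultilinearSeries.ofScalars_apply_eq, mul_comm] using h y hy'
  have h0 := hb.hasFPowerSeriesAt.eq_zero
  have := congrArg (fun p : FormalMultilinearSeries ℂ ℂ ℂ => p.coeff n) h0
  rw [FormalMultilinearSeries.coeff_ofScalars] at this
  rw [this]; rfl

theorem eval₁_injective {f g : H2Disk} (h : ∀ z ∈ disk, eval₁ f z = eval₁ g z) : f = g := by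
  rw [← sub_eq_zero]
  ext n
  refine coeff_eq_zero_of_hasSum (fun z hz => ?_) n
  have := (summable_eval₁ (f - g) hz).hasSum
  rwa [← eval₁, eval₁_sub _ _ hz, h z hz, sub_self] at this

theorem memℓp_slice (F : H2Bidisk) (j : ℕ) : Memℓp (fun k => F (j, k)) 2 := by
  have h := lp.memℓp F
  rw [memℓp_gen_iff (by norm_num)] at h ⊢
  exact h.comp_injective (Prod.mk_right_injective j)

/-- The coefficient of `z₁ʲ` of an element of `H²(𝔻²)`, as an element of `H²(𝔻)`. -/
def slice (F : H2Bidisk) (j : ℕ) : H2Disk := ⟨fun k => F (j, k), memℓp_slice F j⟩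

theorem slice_apply (F : H2Bidisk) (j k : ℕ) : slice F j k = F (j, k) := rfl

theorem hasSum_slice (F : H2Bidisk) {z : ℂ × ℂ} (hz : z ∈ bidisk) :
    HasSum (fun j => eval₁ (slice F j) z.2 * z.1 ^ j) (eval₂ F z) := by
  refine (summable_eval₂ F hz).hasSum.prod_fiberwise fun j => ?_
  have := (summable_eval₁ (slice F j) hz.2).hasSum.mul_right (z.1 ^ j)
  refine this.congr_fun fun k => ?_
  rw [slice_apply]; ring

/-- One-variable uniqueness is used twice: in z₁ for fixed z₂, then in z₂ for each coefficient of
z₁ʲ. -/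
theorem eval₂_injective {F G : H2Bidisk} (h : ∀ z ∈ bidisk, eval₂ F z = eval₂ G z) : F = G := by
  rw [← sub_eq_zero]
  have : ∀ j, slice (F - G) j = 0 := fun j => by
    refine eval₁_injective fun w hw => ?_
    rw [eval₁_zero]
    refine coeff_eq_zero_of_hasSum (a := fun j => eval₁ (slice (F - G) j) w) (fun z hz => ?_) j
    have hzw : (z, w) ∈ bidisk := ⟨hz, hw⟩
    have := hasSum_slice (F - G) hzw
    rwa [eval₂_sub _ _ hzw, h _ hzw, sub_self] at this
  ext ⟨j, k⟩
  rw [← slice_apply, this]; rfl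

theorem eval₂_fst_zero (F : H2Bidisk) {w : ℂ} (hw : w ∈ disk) :
    eval₂ F (0, w) = eval₁ (slice F 0) w := by
  refine (hasSum_slice F (z := (0, w)) ⟨by simp, hw⟩).unique ?_
  convert hasSum_ite_eq 0 (eval₁ (slice F 0) w) using 2 with j
  rcases j with _ | j <;> simp

theorem mem_bidisk_fst_zero {z : ℂ × ℂ} (hz : z ∈ bidisk) : ((0 : ℂ), z.2) ∈ bidisk :=
  ⟨by simp, hz.2⟩

theorem eval₂_mulZ₁ (F : H2Bidisk) {z : ℂ × ℂ} (hz : z ∈ bidisk) :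
    eval₂ (mulZ₁ F) z = z.1 * eval₂ F z := by
  refine (hasSum_slice (mulZ₁ F) hz).unique ?_
  rw [← hasSum_nat_add_iff' 1]
  have h0 : slice (mulZ₁ F) 0 = 0 := by ext k; exact mulZ₁_apply_zero F k
  have h1 : ∀ j, slice (mulZ₁ F) (j + 1) = slice F j := fun j => by
    ext k; exact mulZ₁_apply_succ F j k
  simp only [Finset.range_one, Finset.sum_singleton, h0, h1, eval₁_zero, zero_mul, sub_zero]
  refine ((hasSum_slice F hz).mul_left z.1).congr_fun fun j => ?_
  ring

theorem eval₁_shift (f : H2Disk) {z : ℂ} (hz : z ∈ disk) :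
    eval₁ (shift f) z = z * eval₁ f z := by
  refine (summable_eval₁ (shift f) hz).hasSum.unique ?_
  rw [← hasSum_nat_add_iff' 1]
  simp only [Finset.range_one, Finset.sum_singleton, shift_apply_zero, shift_apply_succ, zero_mul,
    sub_zero]
  refine ((summable_eval₁ f hz).hasSum.mul_left z).congr_fun fun j => ?_
  ring

theorem eval₂_mulZ₂ (F : H2Bidisk) {z : ℂ × ℂ} (hz : z ∈ bidisk) :
    eval₂ (mulZ₂ F) z = z.2 * eval₂ F z := by
  refine (hasSum_slice (mulZ₂ F) hz).unique ?_
  have h1 : ∀ j, slice (mulZ₂ F) j = shift (slice F j) := fun j => by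
    ext k
    rcases k with _ | k
    · rw [slice_apply, mulZ₂_apply_zero, shift_apply_zero]
    · rw [slice_apply, mulZ₂_apply_succ, shift_apply_succ, slice_apply]
  refine ((hasSum_slice F hz).mul_left z.2).congr_fun fun j => ?_
  rw [h1, eval₁_shift _ hz.2]; ring

/-- `M_{z₁}*` is the backward shift in `z₁`. -/
theorem mul_eval₂_adjoint_mulZ₁ (F : H2Bidisk) {z : ℂ × ℂ} (hz : z ∈ bidisk) :
    z.1 * eval₂ (ContinuousLinearMap.adjoint mulZ₁ F) z = eval₂ F z - eval₂ F (0, z.2) := by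
  refine ((hasSum_slice (ContinuousLinearMap.adjoint mulZ₁ F) hz).mul_left z.1).unique ?_
  have h := (hasSum_nat_add_iff' 1).2 (hasSum_slice F hz)
  rw [Finset.range_one, Finset.sum_singleton, pow_zero, mul_one, ← eval₂_fst_zero F hz.2] at h
  refine h.congr_fun fun j => ?_
  have h1 : slice (ContinuousLinearMap.adjoint mulZ₁ F) j = slice F (j + 1) := by
    ext k; exact adjoint_mulZ₁_apply F j k
  rw [h1]; ring

theorem mulZ₁_injective : Function.Injective mulZ₁ := LinearIsometry.injective _

theorem adjoint_mulZ₁_eq {F G : H2Bidisk}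
    (h : ∀ z ∈ bidisk, eval₂ F z - eval₂ F (0, z.2) = z.1 * eval₂ G z) :
    ContinuousLinearMap.adjoint mulZ₁ F = G := by
  refine mulZ₁_injective (eval₂_injective fun z hz => ?_)
  rw [eval₂_mulZ₁ _ hz, eval₂_mulZ₁ _ hz, mul_eval₂_adjoint_mulZ₁ _ hz, h z hz]

/-! ### Reproducing kernels -/

theorem memℓp_geometric {w : ℂ} (hw : w ∈ disk) : Memℓp (fun n : ℕ => conj w ^ n) 2 := by
  rw [memℓp_gen_iff (by norm_num)]
  have hw' : ‖w‖ ^ 2 < 1 := by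
    have : ‖w‖ < 1 := hw
    nlinarith [norm_nonneg w]
  refine (summable_geometric_of_lt_one (by positivity) hw').congr fun n => ?_
  simp [← pow_mul, mul_comm]

/-- The Szegő kernel function `1 / (1 - w̄ z)` of the disk. -/
def szego (w : ℂ) (hw : w ∈ disk) : H2Disk := ⟨fun n => conj w ^ n, memℓp_geometric hw⟩

theorem inner_szego {w : ℂ} (hw : w ∈ disk) (f : H2Disk) : ⟪szego w hw, f⟫_ℂ = eval₁ f w := by
  rw [lp.inner_eq_tsum, eval₁]
  refine tsum_congr fun n => ?_
  simp [szego]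

theorem norm_mul_lt_one {z w : ℂ} (hz : z ∈ disk) (hw : w ∈ disk) : ‖z * conj w‖ < 1 := by
  have hz' : ‖z‖ < 1 := hz
  have hw' : ‖w‖ < 1 := hw
  rw [norm_mul, RCLike.norm_conj]
  nlinarith [norm_nonneg z, norm_nonneg w]

theorem eval₁_szego {w z : ℂ} (hw : w ∈ disk) (hz : z ∈ disk) :
    eval₁ (szego w hw) z = (1 - z * conj w)⁻¹ := by
  rw [← tsum_geometric_of_norm_lt_one (norm_mul_lt_one hz hw), eval₁]
  refine tsum_congr fun n => ?_
  rw [mul_comm z, mul_pow]; rfl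

theorem continuous_eval₂ {z : ℂ × ℂ} (hz : z ∈ bidisk) : Continuous fun F => eval₂ F z := by
  have h : Summable fun n : ℕ × ℕ => ‖z.1‖ ^ n.1 * ‖z.2‖ ^ n.2 :=
    (summable_geometric_of_lt_one (norm_nonneg _) hz.1).mul_of_nonneg
      (summable_geometric_of_lt_one (norm_nonneg _) hz.2)
      (fun _ => by positivity) (fun _ => by positivity)
  let L : H2Bidisk →ₗ[ℂ] ℂ :=
    { toFun := fun F => eval₂ F z
      map_add' := fun F G => eval₂_add F G hz
      map_smul' := fun r F => eval₂_smul r F z }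
  refine (L.mkContinuous (∑' n : ℕ × ℕ, ‖z.1‖ ^ n.1 * ‖z.2‖ ^ n.2) fun F => ?_).continuous
  rw [mul_comm, ← tsum_mul_left]
  refine tsum_of_norm_bounded (h.mul_left ‖F‖).hasSum fun n => ?_
  rw [norm_mul, norm_mul, norm_pow, norm_pow]
  gcongr
  exact lp.norm_apply_le_norm (by norm_num) F n

/-! ### Elements of `H²(𝔻²)` with prescribed coefficients in `z₁` -/

theorem norm_sq_eq_tsum {ι : Type*} (f : lp (fun _ : ι => ℂ) 2) :
    HasSum (fun i => ‖f i‖ ^ 2) (‖f‖ ^ 2) := by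
  have := lp.hasSum_norm (p := 2) (by norm_num) f
  simpa using this

theorem memℓp_ofSlices {u : ℕ → H2Disk} (hu : Summable fun n => ‖u n‖ ^ 2) :
    Memℓp (fun n : ℕ × ℕ => u n.1 n.2) 2 := by
  rw [memℓp_gen_iff (by norm_num)]
  have : Summable fun n : ℕ × ℕ => ‖u n.1 n.2‖ ^ 2 := by
    rw [summable_prod_of_nonneg (fun _ => by positivity)]
    refine ⟨fun n => (norm_sq_eq_tsum (u n)).summable, hu.congr fun n => ?_⟩
    exact (norm_sq_eq_tsum (u n)).tsum_eq.symm
  simpa using this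

/-- The element `∑ z₁ⁿ uₙ(z₂)` of `H²(𝔻²)`. -/
def ofSlices (u : ℕ → H2Disk) (hu : Summable fun n => ‖u n‖ ^ 2) : H2Bidisk :=
  ⟨fun n : ℕ × ℕ => u n.1 n.2, memℓp_ofSlices hu⟩

theorem norm_sq_ofSlices (u : ℕ → H2Disk) (hu : Summable fun n => ‖u n‖ ^ 2) :
    HasSum (fun n => ‖u n‖ ^ 2) (‖ofSlices u hu‖ ^ 2) :=
  (norm_sq_eq_tsum (ofSlices u hu)).prod_fiberwise fun n => norm_sq_eq_tsum (u n)

/-! ### Isometries of a Hilbert space -/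

section Operators

variable {X : Type*} [NormedAddCommGroup X] [InnerProductSpace ℂ X] [CompleteSpace X]

/-- An operator `V` is pure if the ranges of its powers intersect trivially. -/
def IsPure (V : X →L[ℂ] X) : Prop := ∀ x, (∀ n : ℕ, ∃ y, (V ^ n) y = x) → x = 0

/-- Neumann series for a(1 + (c/a)V), as ‖(c/a)V‖ < 1. -/
theorem exists_inverse_affine {V : X →L[ℂ] X} (hV : ∀ x, ‖V x‖ = ‖x‖) {a c : ℂ} (h : ‖c‖ < ‖a‖) :
    ∃ R : X →L[ℂ] X, (a • 1 + c • V) * R = 1 ∧ R * (a • 1 + c • V) = 1 ∧ Commute V R := by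
  have ha : a ≠ 0 := norm_pos_iff.1 ((norm_nonneg c).trans_lt h)
  have hV1 : ‖V‖ ≤ 1 := V.opNorm_le_bound zero_le_one fun x => by rw [hV, one_mul]
  have hlt : ‖(-(c / a)) • V‖ < 1 := by
    rw [norm_smul, norm_neg, norm_div]
    have : ‖c‖ / ‖a‖ < 1 := (div_lt_one (norm_pos_iff.2 ha)).2 h
    nlinarith [norm_nonneg V, div_nonneg (norm_nonneg c) (norm_nonneg a)]
  have hu : IsUnit (a • 1 + c • V) := by
    have h1 := (isUnit_one_sub_of_norm_lt_one hlt).smul (Units.mk0 a ha)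
    convert h1 using 1
    rw [Units.smul_def, Units.val_mk0, smul_sub, smul_smul, mul_neg, mul_div_cancel₀ _ ha,
      neg_smul, sub_neg_eq_add]
  obtain ⟨u, hu⟩ := hu
  refine ⟨↑u⁻¹, by rw [← hu, Units.mul_inv], by rw [← hu, Units.inv_mul], ?_⟩
  refine Commute.units_inv_right ?_
  rw [hu]
  exact ((Commute.one_right V).smul_right a).add_right ((Commute.refl V).smul_right c)

theorem adjoint_apply_self {V : X →L[ℂ] X} (hV : ∀ x, ‖V x‖ = ‖x‖) (x : X) :
    ContinuousLinearMap.adjoint V (V x) = x := by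
  have := (ContinuousLinearMap.norm_map_iff_adjoint_comp_self V).1 hV
  exact congrArg (fun A : X →L[ℂ] X => A x) this

theorem inner_map_map {V : X →L[ℂ] X} (hV : ∀ x, ‖V x‖ = ‖x‖) (x y : X) :
    ⟪V x, V y⟫_ℂ = ⟪x, y⟫_ℂ := by
  rw [← ContinuousLinearMap.adjoint_inner_right, adjoint_apply_self hV]

/-- For an isometry, ‖VV*x - x‖² = ‖x‖² - ‖V*x‖². -/
theorem apply_adjoint_of_norm_le {V : X →L[ℂ] X} (hV : ∀ x, ‖V x‖ = ‖x‖) {x : X}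
    (h : ‖x‖ ≤ ‖ContinuousLinearMap.adjoint V x‖) : V (ContinuousLinearMap.adjoint V x) = x := by
  rw [← sub_eq_zero, ← norm_eq_zero, ← sq_eq_zero_iff]
  refine le_antisymm ?_ (sq_nonneg _)
  rw [@norm_sub_sq ℂ, hV, ← ContinuousLinearMap.adjoint_inner_right, inner_self_eq_norm_sq]
  nlinarith [norm_nonneg x]

theorem norm_adjoint_apply_le {C : X →L[ℂ] X} (hC : ∀ x, ‖C x‖ ≤ ‖x‖) (x : X) :
    ‖ContinuousLinearMap.adjoint C x‖ ≤ ‖x‖ := by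
  have h1 : ‖C‖ ≤ 1 := C.opNorm_le_bound zero_le_one fun x => by simpa using hC x
  have := (ContinuousLinearMap.adjoint C).le_of_opNorm_le (c := 1) (by simpa using h1) x
  simpa using this

/-- If `V` is a pure isometry and `C` a contraction commuting with `V`, then `1 - C V` has dense
range. -/
theorem IsPure.denseRange_one_sub {V C : X →L[ℂ] X} (hp : IsPure V) (hV : ∀ x, ‖V x‖ = ‖x‖)
    (hC : ∀ x, ‖C x‖ ≤ ‖x‖) (hVC : Commute V C) : DenseRange (1 - C * V : X →L[ℂ] X) := by
  -- A vector orthogonal to the range is a fixed point of C*V*. Then ‖g‖ ≤ ‖V*g‖ forces g = VV*g,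
  -- and V*g is again a fixed point, so by induction g lies in the range of every power of V.
  have key : ∀ n : ℕ, ∀ g : X,
      ContinuousLinearMap.adjoint C (ContinuousLinearMap.adjoint V g) = g →
        ∃ y, (V ^ n) y = g := by
    intro n
    induction n with
    | zero => exact fun g _ => ⟨g, rfl⟩
    | succ n ih =>
      intro g hg
      have hcomm : ∀ x, ContinuousLinearMap.adjoint C (ContinuousLinearMap.adjoint V x) =
          ContinuousLinearMap.adjoint V (ContinuousLinearMap.adjoint C x) := fun x => by
        refine ext_inner_right ℂ fun y => ?_
        simp only [ContinuousLinearMap.adjoint_inner_left]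
        rw [← mul_apply_eq_comp, ← mul_apply_eq_comp, hVC.eq]
      obtain ⟨y, hy⟩ := ih (ContinuousLinearMap.adjoint V g) (by
        conv_rhs => rw [← hg]
        rw [← hcomm])
      refine ⟨y, ?_⟩
      rw [pow_succ', mul_apply_eq_comp, hy]
      refine apply_adjoint_of_norm_le hV ?_
      conv_lhs => rw [← hg]
      exact norm_adjoint_apply_le hC _
  have hd : (LinearMap.range (1 - C * V : X →L[ℂ] X).toLinearMap).topologicalClosure = ⊤ := by
    rw [Submodule.topologicalClosure_eq_top_iff, Submodule.eq_bot_iff]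
    intro g hg
    refine hp g fun n => key n g ?_
    refine ext_inner_right ℂ fun y => ?_
    have := (Submodule.mem_orthogonal' _ _).1 hg ((1 - C * V) y) ⟨y, rfl⟩
    simp only [ContinuousLinearMap.adjoint_inner_left]
    have hy : (1 - C * V : X →L[ℂ] X) y = y - C (V y) := rfl
    rw [hy, inner_sub_right, sub_eq_zero] at this
    rw [this, ← mul_apply_eq_comp, ← mul_apply_eq_comp C, hVC.eq]
  exact Submodule.dense_iff_topologicalClosure_eq_top.2 hd

end Operators

section Contractions

variable {X : Type*} [NormedAddCommGroup X] [InnerProductSpace ℂ X]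

/-- If `Ψ` and `Φ` commute, `Ψ*Ψ + Φ*Φ = 1` and `Φ` has dense range, then
`∑ₙ ‖Ψⁿ Φ x‖² = ‖x‖²`. -/
theorem hasSum_norm_sq_pow {Ψ Φ : X →L[ℂ] X} (hcomm : Commute Ψ Φ)
    (h : ∀ x, ‖x‖ ^ 2 = ‖Ψ x‖ ^ 2 + ‖Φ x‖ ^ 2) (hd : DenseRange Φ) (x : X) :
    HasSum (fun n : ℕ => ‖(Ψ ^ n) (Φ x)‖ ^ 2) (‖x‖ ^ 2) := by
  have hle : ∀ x, ‖Ψ x‖ ≤ ‖x‖ := fun x => by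
    refine le_of_sq_le_sq ?_ (norm_nonneg _)
    nlinarith [h x, sq_nonneg ‖Φ x‖]
  have hple : ∀ (n : ℕ) x, ‖(Ψ ^ n) x‖ ≤ ‖x‖ := fun n => by
    induction n with
    | zero => simp
    | succ n ih =>
      intro x
      rw [pow_succ', mul_apply_eq_comp]
      exact (hle _).trans (ih x)
  -- By commutation the n-th term is ‖ΦΨⁿx‖² = ‖Ψⁿx‖² - ‖Ψⁿ⁺¹x‖², and the sum telescopes.
  have hsum : ∀ x (N : ℕ), ∑ n ∈ Finset.range N, ‖(Ψ ^ n) (Φ x)‖ ^ 2 =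
      ‖x‖ ^ 2 - ‖(Ψ ^ N) x‖ ^ 2 := fun x N => by
    induction N with
    | zero => simp
    | succ N ih =>
      have hc : (Ψ ^ N) (Φ x) = Φ ((Ψ ^ N) x) := by
        rw [← mul_apply_eq_comp, (hcomm.pow_left N).eq, mul_apply_eq_comp]
      rw [Finset.sum_range_succ, ih, hc, pow_succ' Ψ, mul_apply_eq_comp,
        h ((Ψ ^ N) x)]
      ring
  have hS : ∀ x, Summable fun n : ℕ => ‖(Ψ ^ n) (Φ x)‖ ^ 2 := fun x =>
    summable_of_sum_range_le (fun _ => by positivity) fun N => by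
      rw [hsum x N]; exact sub_le_self _ (by positivity)
  -- On the range of Φ the powers tend to 0 because the series is summable; density and ‖Ψⁿ‖ ≤ 1
  -- carry this to every x.
  have h0 : Tendsto (fun n : ℕ => ‖(Ψ ^ n) x‖) atTop (𝓝 0) := by
    rw [Metric.tendsto_atTop]
    intro ε hε
    obtain ⟨y, hy⟩ := hd.exists_dist_lt x (half_pos hε)
    have hy0 : Tendsto (fun n : ℕ => ‖(Ψ ^ n) (Φ y)‖) atTop (𝓝 0) := by
      have := (hS y).tendsto_atTop_zero.sqrt
      simpa using this
    obtain ⟨N, hN⟩ := (Metric.tendsto_atTop.1 hy0) (ε / 2) (half_pos hε)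
    refine ⟨N, fun n hn => ?_⟩
    have h1 := hN n hn
    have h2 := hple n (x - Φ y)
    rw [map_sub] at h2
    have h3 := norm_sub_norm_le ((Ψ ^ n) x) ((Ψ ^ n) (Φ y))
    rw [dist_eq_norm] at hy
    rw [Real.dist_eq, sub_zero, abs_of_nonneg (norm_nonneg _)] at h1 ⊢
    linarith
  rw [(hS x).hasSum_iff_tendsto_nat]
  simp only [hsum]
  simpa using (h0.pow 2).const_sub (‖x‖ ^ 2)

end Contractions

/-! ### Rational inner functions of degree `(1,1)` with a singularity on the torus -/

namespace BiAffine

/-- The relations between the coefficients of `p`, `l` and `t` that hold when `p̃ / p` is inner of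
degree `(1,1)`, `p` vanishes at a point of `𝕋²` with second coordinate `t`, and
`l² = ā c - d b̄`. -/
structure Regular (p : BiAffine) (l t : ℂ) : Prop where
  eval_ne_zero : ∀ z ∈ bidisk, p.eval z ≠ 0
  norm_c_lt : ‖p.c‖ < ‖p.a‖
  sq_eq : l ^ 2 = conj p.a * p.c - p.d * conj p.b
  norm_t : ‖t‖ = 1
  l_ne_zero : l ≠ 0
  sq_eq' : l ^ 2 = -(l * conj l * conj t)
  norm_sum : p.a * conj p.a + p.c * conj p.c - p.b * conj p.b - p.d * conj p.d = 2 * (l * conj l)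

/-- The zero `z₁ = 1 / ψ(z₂)` of `p`. -/
def psi (p : BiAffine) (z : ℂ) : ℂ := -((p.b + p.d * z) / (p.a + p.c * z))

/-- `f(0, z₂)`. -/
def phi (p : BiAffine) (l t z : ℂ) : ℂ := l * ((z - t) / (p.a + p.c * z))

/-- `θ(0, z₂)`. -/
def zeta (p : BiAffine) (z : ℂ) : ℂ := (conj p.b * z + conj p.d) / (p.a + p.c * z)

namespace Regular

variable {p : BiAffine} {l t : ℂ}

theorem denom_ne_zero (h : p.Regular l t) {z : ℂ} (hz : ‖z‖ ≤ 1) : p.a + p.c * z ≠ 0 := by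
  intro h0
  have h1 : ‖p.a‖ = ‖p.c‖ * ‖z‖ := by
    rw [eq_neg_of_add_eq_zero_left h0, norm_neg, norm_mul]
  have := h.norm_c_lt
  nlinarith [norm_nonneg p.c]

theorem t_mul_conj (h : p.Regular l t) : t * conj t = 1 := by
  rw [RCLike.mul_conj, h.norm_t]; norm_num

/-- Since p = A(1 - z₁ψ), f is φ/(1 - z₁ψ). -/
theorem reproducing_sub (h : p.Regular l t) {z : ℂ × ℂ} (hz : z ∈ bidisk) :
    p.reproducing l t z - p.phi l t z.2 = z.1 * (p.psi z.2 * p.reproducing l t z) := by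
  have h1 := h.eval_ne_zero z hz
  have h2 := h.denom_ne_zero (z := z.2) hz.2.le
  have he : p.eval z = (p.a + p.c * z.2) + z.1 * (p.b + p.d * z.2) := by rw [eval]; ring
  rw [reproducing, phi, psi]
  generalize p.a + p.c * z.2 = A at *
  field_simp
  rw [he]
  ring

theorem inner_sub (h : p.Regular l t) {z : ℂ × ℂ} (hz : z ∈ bidisk) :
    p.inner z - p.zeta z.2 = z.1 * (p.phi l t z.2 * p.reproducing l t z) := by
  have h1 := h.eval_ne_zero z hz
  have h2 := h.denom_ne_zero (z := z.2) hz.2.le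
  have ht := h.t_mul_conj
  -- The determinant of p̃ and p, as affine functions of z₁, is a quadratic in z₂. The relations in
  -- `Regular` make it a perfect square with double zero t, which is why the difference factors as φ
  -- times f.
  have h3 : (conj p.c + conj p.a * z.2) * (p.a + p.c * z.2) -
      (conj p.b * z.2 + conj p.d) * (p.b + p.d * z.2) = l ^ 2 * (z.2 - t) ^ 2 := by
    have e1 := h.sq_eq
    have e2 := h.norm_sum
    have e3 := h.sq_eq'
    have e4 : conj (l ^ 2) = conj (conj p.a * p.c - p.d * conj p.b) := by rw [e1]
    have e5 : conj (l ^ 2) = conj (-(l * conj l * conj t)) := by rw [e3]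
    simp only [map_sub, map_mul, map_neg, Complex.conj_conj] at e4 e5
    have e6 : l ^ 2 * t = -(l * conj l) := by
      rw [e3]; linear_combination (-(l * conj l)) * ht
    linear_combination (-z.2 ^ 2) * e1 + z.2 * e2 - e4 + e5 + (2 * z.2 - t) * e6
  have he : p.eval z = (p.a + p.c * z.2) + z.1 * (p.b + p.d * z.2) := by rw [eval]; ring
  have hn : p.tilde.eval z = (conj p.b * z.2 + conj p.d) + z.1 * (conj p.c + conj p.a * z.2) := by
    rw [eval, tilde]; ring
  rw [inner, zeta, reproducing, phi, hn]
  generalize p.a + p.c * z.2 = A at *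
  field_simp
  rw [he]
  linear_combination z.1 * h3

end Regular

end BiAffine

/-! ### Coefficient relations forced by a zero on the torus -/

namespace BiAffine

variable {p : BiAffine}

theorem IsInner.not_dvd (hp : p.IsInner) {q : MvPolynomial (Fin 2) ℂ} {x : Fin 2 → ℂ}
    (hx : MvPolynomial.eval x q = 0) (h : q ∣ p.toMvPolynomial) :
    ¬ q ∣ p.tilde.toMvPolynomial := fun h' => by
  have := (hp.2 h h').map (MvPolynomial.eval x)
  rw [hx] at this
  exact not_isUnit_zero this

theorem IsInner.a_ne_zero (hp : p.IsInner) : p.a ≠ 0 := by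
  have := hp.1 (0, 0) ⟨by simp, by simp⟩
  simpa [eval] using this

theorem IsInner.norm_c_le (hp : p.IsInner) : ‖p.c‖ ≤ ‖p.a‖ := by
  by_contra! h
  have hc : p.c ≠ 0 := norm_pos_iff.1 ((norm_nonneg _).trans_lt h)
  refine hp.1 (0, -p.a / p.c) ⟨by simp, ?_⟩ ?_
  · rw [norm_div, norm_neg]
    exact (div_lt_one (norm_pos_iff.2 hc)).2 h
  · simp only [eval]; field_simp; ring

/-- If |B(w)| > |A(w)| for some w in the disk, then p vanishes at (-A(w)/B(w), w) in the bidisk. The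
inequality passes to the circle by closure. -/
theorem IsInner.norm_le (hp : p.IsInner) {z : ℂ} (hz : ‖z‖ = 1) :
    ‖p.b + p.d * z‖ ≤ ‖p.a + p.c * z‖ := by
  have hcl : IsClosed {z : ℂ | ‖p.b + p.d * z‖ ≤ ‖p.a + p.c * z‖} :=
    isClosed_le (by fun_prop) (by fun_prop)
  have hsub : Metric.ball (0 : ℂ) 1 ⊆ {z : ℂ | ‖p.b + p.d * z‖ ≤ ‖p.a + p.c * z‖} := by
    intro w hw
    rw [mem_ball_zero_iff] at hw
    by_contra! h
    have hb : p.b + p.d * w ≠ 0 := norm_pos_iff.1 ((norm_nonneg _).trans_lt (not_le.1 h))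
    refine hp.1 (-(p.a + p.c * w) / (p.b + p.d * w), w) ⟨?_, hw⟩ ?_
    · rw [norm_div, norm_neg]
      exact (div_lt_one (norm_pos_iff.2 hb)).2 (not_le.1 h)
    · have : p.eval (-(p.a + p.c * w) / (p.b + p.d * w), w) = (p.a + p.c * w) +
          (p.b + p.d * w) * (-(p.a + p.c * w) / (p.b + p.d * w)) := by simp only [eval]; ring
      rw [this, mul_div_cancel₀ _ hb, add_neg_cancel]
  have := closure_minimal hsub hcl
  rw [closure_ball (0 : ℂ) one_ne_zero] at this
  exact this (by simp [hz])

/-- If |c| = |a|, then A vanishes at a point z of the circle, hence so does B by `norm_le`, and z₂ -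
z divides both p and p̃. -/
theorem IsInner.norm_c_lt (hp : p.IsInner) : ‖p.c‖ < ‖p.a‖ := by
  refine hp.norm_c_le.lt_of_ne fun h => ?_
  have ha := hp.a_ne_zero
  have hc : p.c ≠ 0 := norm_ne_zero_iff.1 (h ▸ norm_ne_zero_iff.2 ha)
  set z := -p.a / p.c with hz
  have hz1 : ‖z‖ = 1 := by rw [hz, norm_div, norm_neg, h, div_self (norm_ne_zero_iff.2 ha)]
  have ha' : p.a = -(p.c * z) := by rw [hz]; field_simp
  have hb' : p.b = -(p.d * z) := by
    have := hp.norm_le hz1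
    rw [ha', neg_add_cancel, norm_zero] at this
    exact eq_neg_of_add_eq_zero_left (norm_le_zero_iff.1 this)
  have hzz : conj z * z = 1 := by rw [RCLike.conj_mul, hz1]; norm_num
  have hzC : (MvPolynomial.C (conj z) * MvPolynomial.C z : MvPolynomial (Fin 2) ℂ) = 1 := by
    rw [← map_mul, hzz, map_one]
  refine hp.not_dvd (q := MvPolynomial.X 1 - MvPolynomial.C z) (x := ![0, z]) (by simp)
    ⟨MvPolynomial.C p.c + MvPolynomial.C p.d * MvPolynomial.X 0, ?_⟩
    ⟨-MvPolynomial.C (conj z) *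
      (MvPolynomial.C (conj p.d) + MvPolynomial.C (conj p.c) * MvPolynomial.X 0), ?_⟩
  · rw [toMvPolynomial, ha', hb']
    simp only [map_neg, map_mul]
    ring
  · simp only [toMvPolynomial, tilde]
    rw [ha', hb']
    simp only [map_neg, map_mul]
    linear_combination (-(MvPolynomial.C (conj p.d) +
      MvPolynomial.C (conj p.c) * MvPolynomial.X 0)) * hzC

/-- The two relations force |a| = |b| or |a| = |d|. In the first case p and p̃ share a factor 1 +
uz₁ with |u| = 1. In the second p̃ is a constant multiple of p, which is not a unit because it
vanishes at τ. -/
theorem IsInner.not_degenerate (hp : p.IsInner) {τ : ℂ × ℂ} (hτ : p.eval τ = 0)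
    (hβ : conj p.a * p.c = p.d * conj p.b)
    (hA : ‖p.a‖ ^ 2 + ‖p.c‖ ^ 2 = ‖p.b‖ ^ 2 + ‖p.d‖ ^ 2) : False := by
  have ha := hp.a_ne_zero
  have ha' : conj p.a ≠ 0 := (map_ne_zero _).2 ha
  have hn : ‖p.a‖ * ‖p.c‖ = ‖p.d‖ * ‖p.b‖ := by
    have := congrArg norm hβ
    simpa using this
  -- Multiply `hA` by |a|² and replace |a|²|c|² by |b|²|d|².
  have hfac : (‖p.a‖ ^ 2 - ‖p.b‖ ^ 2) * (‖p.a‖ ^ 2 - ‖p.d‖ ^ 2) = 0 := by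
    linear_combination ‖p.a‖ ^ 2 * hA - (‖p.a‖ * ‖p.c‖ + ‖p.d‖ * ‖p.b‖) * hn
  rcases mul_eq_zero.1 hfac with h | h
  · have h1 : ‖p.a‖ = ‖p.b‖ := by
      have := sub_eq_zero.1 h
      exact (pow_left_inj₀ (norm_nonneg _) (norm_nonneg _) two_ne_zero).1 this
    obtain ⟨u, hu⟩ : ∃ u, u = p.b / p.a := ⟨_, rfl⟩
    have hu1 : ‖u‖ = 1 := by rw [hu, norm_div, h1, div_self (h1 ▸ norm_ne_zero_iff.2 ha)]
    have hb : p.b = u * p.a := by rw [hu]; field_simp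
    have huu : conj u * u = 1 := by rw [RCLike.conj_mul, hu1]; norm_num
    have hc : p.d = u * p.c := by
      rw [hb, map_mul] at hβ
      have : p.c = p.d * conj u := mul_left_cancel₀ ha' (by rw [hβ]; ring)
      rw [this]; linear_combination (-p.d) * huu
    have huC : (MvPolynomial.C (conj u) * MvPolynomial.C u : MvPolynomial (Fin 2) ℂ) = 1 := by
      rw [← map_mul, huu, map_one]
    refine hp.not_dvd (q := 1 + MvPolynomial.C u * MvPolynomial.X 0) (x := ![-conj u, 0])
      (by simp [mul_comm u, huu])
      ⟨MvPolynomial.C p.a + MvPolynomial.C p.c * MvPolynomial.X 1, ?_⟩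
      ⟨MvPolynomial.C (conj u) *
        (MvPolynomial.C (conj p.c) + MvPolynomial.C (conj p.a) * MvPolynomial.X 1), ?_⟩
    · rw [toMvPolynomial, hb, hc]
      simp only [map_mul]
      ring
    · simp only [toMvPolynomial, tilde]
      rw [hb, hc]
      simp only [map_mul]
      linear_combination (-(MvPolynomial.C (conj p.c) +
        MvPolynomial.C (conj p.a) * MvPolynomial.X 1) * MvPolynomial.X 0) * huC
  · have h1 : ‖p.a‖ = ‖p.d‖ := by
      have := sub_eq_zero.1 h
      exact (pow_left_inj₀ (norm_nonneg _) (norm_nonneg _) two_ne_zero).1 this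
    obtain ⟨v, hv⟩ : ∃ v, v = p.d / conj p.a := ⟨_, rfl⟩
    have hv1 : ‖v‖ = 1 := by
      rw [hv, norm_div, RCLike.norm_conj, h1, div_self (h1 ▸ norm_ne_zero_iff.2 ha)]
    have hd : p.d = v * conj p.a := by rw [hv]; field_simp
    have hvv : conj v * v = 1 := by rw [RCLike.conj_mul, hv1]; norm_num
    have hc : p.c = v * conj p.b := by
      rw [hd] at hβ
      exact mul_left_cancel₀ ha' (by rw [hβ]; ring)
    have hvC : (MvPolynomial.C (conj v) * MvPolynomial.C v : MvPolynomial (Fin 2) ℂ) = 1 := by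
      rw [← map_mul, hvv, map_one]
    refine hp.not_dvd (q := p.toMvPolynomial) (x := ![τ.1, τ.2]) ?_ dvd_rfl
      ⟨MvPolynomial.C (conj v), ?_⟩
    · rw [← hτ]; simp [toMvPolynomial, eval]
    · simp only [toMvPolynomial, tilde]
      rw [hd, hc]
      simp only [map_mul, Complex.conj_conj]
      linear_combination (-(MvPolynomial.C (conj p.b) * MvPolynomial.X 1) -
        MvPolynomial.C (conj p.a) * (MvPolynomial.X 0 * MvPolynomial.X 1)) * hvC

/-- Makes |A|² - |B|² visible as a real trigonometric polynomial of degree one, whose coefficient of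
z is the quantity that l² equals. -/
theorem norm_sq_sub_norm_sq (p : BiAffine) {z : ℂ} (hz : ‖z‖ = 1) :
    ‖p.a + p.c * z‖ ^ 2 - ‖p.b + p.d * z‖ ^ 2 =
      (‖p.a‖ ^ 2 + ‖p.c‖ ^ 2 - ‖p.b‖ ^ 2 - ‖p.d‖ ^ 2) +
        2 * ((conj p.a * p.c - p.d * conj p.b) * z).re := by
  have hzz : z * conj z = 1 := by rw [RCLike.mul_conj, hz]; norm_num
  have hre : ((2 * ((conj p.a * p.c - p.d * conj p.b) * z).re : ℝ) : ℂ) =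
      (conj p.a * p.c - p.d * conj p.b) * z + conj ((conj p.a * p.c - p.d * conj p.b) * z) := by
    rw [Complex.add_conj]
  have : ∀ w : ℂ, ((‖w‖ ^ 2 : ℝ) : ℂ) = w * conj w := fun w => by
    rw [RCLike.mul_conj]; norm_num
  apply Complex.ofReal_injective
  rw [Complex.ofReal_add, hre]
  simp only [Complex.ofReal_sub, Complex.ofReal_add, this, map_add, map_mul, map_sub,
    Complex.conj_conj]
  linear_combination (p.c * conj p.c - p.d * conj p.d) * hzz

/-- On the circle |A|² - |B|² is a constant plus 2 Re(l²z). It is nonnegative by `norm_le` and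
vanishes at τ₂ because |τ₁| = 1. So the constant is exactly 2|l|² and the minimum of Re(l²z) is
attained at τ₂, that is, l²τ₂ = -|l|². -/
theorem IsInner.regular (hp : p.IsInner) {τ : ℂ × ℂ}
    (hτ : ‖τ.1‖ = 1 ∧ ‖τ.2‖ = 1 ∧ p.eval τ = 0) {l : ℂ}
    (hl : l ^ 2 = conj p.a * p.c - p.d * conj p.b) : p.Regular l τ.2 := by
  obtain ⟨hτ1, hτ2, hτ0⟩ := hτ
  have hA : (‖p.a‖ ^ 2 + ‖p.c‖ ^ 2 - ‖p.b‖ ^ 2 - ‖p.d‖ ^ 2) + 2 * (l ^ 2 * τ.2).re = 0 := by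
    rw [hl, ← norm_sq_sub_norm_sq p hτ2, sub_eq_zero]
    have h1 : p.a + p.c * τ.2 = -(τ.1 * (p.b + p.d * τ.2)) := by
      rw [eval] at hτ0; linear_combination hτ0
    rw [h1, norm_neg, norm_mul, hτ1, one_mul]
  have hl0 : l ≠ 0 := by
    rintro rfl
    rw [zero_pow two_ne_zero] at hl hA
    refine hp.not_degenerate hτ0 (sub_eq_zero.1 hl.symm) ?_
    simp only [zero_mul, Complex.zero_re] at hA
    linarith
  have hn : ‖l ^ 2‖ ≠ 0 := norm_ne_zero_iff.2 (pow_ne_zero _ hl0)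
  have hge : 2 * ‖l ^ 2‖ ≤ ‖p.a‖ ^ 2 + ‖p.c‖ ^ 2 - ‖p.b‖ ^ 2 - ‖p.d‖ ^ 2 := by
    -- This point of the circle minimizes Re(l²z).
    have hu : ‖-(conj (l ^ 2) / (‖l ^ 2‖ : ℂ))‖ = 1 := by
      rw [norm_neg, norm_div, RCLike.norm_conj, Complex.norm_real, norm_norm, div_self hn]
    have h1 := norm_sq_sub_norm_sq p hu
    have h2 := hp.norm_le hu
    have h3 : l ^ 2 * -(conj (l ^ 2) / (‖l ^ 2‖ : ℂ)) = ((-‖l ^ 2‖ : ℝ) : ℂ) := by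
      rw [mul_neg, mul_div_assoc', RCLike.mul_conj]
      have : (‖l ^ 2‖ : ℂ) ≠ 0 := by exact_mod_cast hn
      push_cast
      field_simp
      simp
    rw [← hl, h3, Complex.ofReal_re] at h1
    have h4 := pow_le_pow_left₀ (norm_nonneg _) h2 2
    linarith
  have hle : -(l ^ 2 * τ.2).re ≤ ‖l ^ 2‖ := by
    have := (abs_le.1 (Complex.abs_re_le_norm (l ^ 2 * τ.2))).1
    rw [norm_mul, hτ2, mul_one] at this
    linarith
  have hre : (l ^ 2 * τ.2).re = -‖l ^ 2‖ := by linarith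
  -- A complex number whose real part is minus its modulus has no imaginary part.
  have heq : l ^ 2 * τ.2 = -(l * conj l) := by
    have him : (l ^ 2 * τ.2).im = 0 := by
      have := Complex.sq_norm (l ^ 2 * τ.2)
      rw [norm_mul, hτ2, mul_one, Complex.normSq_apply, hre] at this
      nlinarith
    rw [RCLike.mul_conj]
    refine Complex.ext ?_ ?_
    · rw [hre, norm_pow]; norm_cast
    · rw [him]; norm_cast
  have htt : τ.2 * conj τ.2 = 1 := by rw [RCLike.mul_conj, hτ2]; norm_num
  refine ⟨hp.1, hp.norm_c_lt, hl, hτ2, hl0, ?_, ?_⟩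
  · linear_combination conj τ.2 * heq - l ^ 2 * htt
  · have h1 : ‖p.a‖ ^ 2 + ‖p.c‖ ^ 2 - ‖p.b‖ ^ 2 - ‖p.d‖ ^ 2 = 2 * ‖l‖ ^ 2 := by
      rw [← norm_pow l]; linarith
    simp only [Complex.mul_conj']
    exact_mod_cast h1

end BiAffine

/-! ### Multiplication operators on `H²(𝔻)` and their boundary values -/

/-- `A` is multiplication by `h` on `H²(𝔻)`, where `h` is defined and continuous up to the
boundary. -/
structure IsMultiplication (A : H2Disk →L[ℂ] H2Disk) (h : ℂ → ℂ) : Prop where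
  eval : ∀ g, ∀ z ∈ disk, eval₁ (A g) z = h z * eval₁ g z
  continuous : Continuous fun x : AddCircle (1 : ℝ) => h (AddCircle.toCircle x)
  boundary : ∀ g, boundary (A g) =ᵐ[AddCircle.haarAddCircle]
    fun x : AddCircle (1 : ℝ) => h (AddCircle.toCircle x) * boundary g x

theorem boundary_single (n : ℕ) : boundary (lp.single 2 n (1 : ℂ)) = fourierLp 2 (n : ℤ) :=
  linearIsometry_single ((orthonormal_fourier (T := (1 : ℝ))).comp (fun n : ℕ => (n : ℤ))
    Nat.cast_injective) n

theorem norm_toCircle (x : AddCircle (1 : ℝ)) : ‖(AddCircle.toCircle x : ℂ)‖ = 1 :=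
  Circle.norm_coe _

theorem shift_single (n : ℕ) : shift (lp.single 2 n (1 : ℂ)) = lp.single 2 (n + 1) (1 : ℂ) := by
  rw [← diskBasis_apply (n + 1)]
  exact linearIsometry_single ((HilbertBasis.ofRepr
    (LinearIsometryEquiv.refl ℂ H2Disk)).orthonormal.comp Nat.succ Nat.succ_injective) n

theorem inner_boundary (f g : H2Disk) : ⟪boundary f, boundary g⟫_ℂ = ⟪f, g⟫_ℂ :=
  LinearIsometry.inner_map_map _ f g

theorem coeFn_mulLInfty (φ : LInftyCircle) (g : L2Circle) :
    mulLInfty φ g =ᵐ[AddCircle.haarAddCircle] fun x => φ x * g x := by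
  exact (ContinuousLinearMap.mul ℂ ℂ).coeFn_holder (r := 2) φ g

/-- A continuous function on the circle as an element of `L^∞`. -/
def ofContinuous (u : C(AddCircle (1 : ℝ), ℂ)) : LInftyCircle :=
  ContinuousMap.toLp ∞ AddCircle.haarAddCircle ℂ u

theorem coeFn_ofContinuous (u : C(AddCircle (1 : ℝ), ℂ)) :
    ofContinuous u =ᵐ[AddCircle.haarAddCircle] u :=
  ContinuousMap.coeFn_toLp AddCircle.haarAddCircle u

theorem hasSum_single_smul (f : H2Disk) :
    HasSum (fun n => f n • (lp.single 2 n (1 : ℂ) : H2Disk)) f := by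
  have := lp.hasSum_single (p := 2) (by norm_num) f
  refine this.congr_fun fun n => ?_
  rw [← lp.single_smul, smul_eq_mul, mul_one]

theorem ext_on_single {Y : Type*} [NormedAddCommGroup Y] [NormedSpace ℂ Y]
    {A B : H2Disk →L[ℂ] Y}
    (h : ∀ n, A (lp.single 2 n (1 : ℂ)) = B (lp.single 2 n (1 : ℂ))) : A = B := by
  ext f
  refine (A.hasSum (hasSum_single_smul f)).unique ?_
  refine (B.hasSum (hasSum_single_smul f)).congr_fun fun n => ?_
  simp [h n]

theorem boundary_shift (g : H2Disk) : boundary (shift g) =ᵐ[AddCircle.haarAddCircle]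
    fun x : AddCircle (1 : ℝ) => (AddCircle.toCircle x : ℂ) * boundary g x := by
  have key : boundary ∘L shift = mulLInfty (ofContinuous (fourier 1)) ∘L boundary := by
    refine ext_on_single fun n => ?_
    rw [ContinuousLinearMap.comp_apply, ContinuousLinearMap.comp_apply, shift_single,
      boundary_single, boundary_single]
    refine MeasureTheory.Lp.ext ?_
    filter_upwards [coeFn_mulLInfty (ofContinuous (fourier 1)) (fourierLp 2 (n : ℤ)),
      coeFn_ofContinuous (fourier 1), coeFn_fourierLp (T := (1 : ℝ)) 2 (n : ℤ),
      coeFn_fourierLp (T := (1 : ℝ)) 2 ((n + 1 : ℕ) : ℤ)] with x h1 h2 h3 h4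
    rw [h1, h2, h3, h4, ← fourier_add]
    congr 2
    push_cast; ring
  have := congrArg (fun A : H2Disk →L[ℂ] L2Circle => A g) key
  simp only [ContinuousLinearMap.comp_apply] at this
  rw [this]
  filter_upwards [coeFn_mulLInfty (ofContinuous (fourier 1)) (boundary g),
    coeFn_ofContinuous (fourier 1)] with x h1 h2
  rw [h1, h2, fourier_one]

namespace IsMultiplication

variable {A B : H2Disk →L[ℂ] H2Disk} {h k : ℂ → ℂ}

theorem shift : IsMultiplication shift fun z => z where
  eval := fun g _ hz => eval₁_shift g hz
  continuous := continuous_subtype_val.comp AddCircle.continuous_toCircle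
  boundary := boundary_shift

theorem one : IsMultiplication 1 fun _ => 1 where
  eval := fun g z _ => by simp
  continuous := continuous_const
  boundary := fun g => by simp

theorem zero : IsMultiplication 0 fun _ => 0 where
  eval := fun g z _ => by simp [eval₁_zero]
  continuous := continuous_const
  boundary := fun g => by
    simp only [zero_apply, map_zero, zero_mul]
    exact MeasureTheory.Lp.coeFn_zero _ _ _

theorem smul (hA : IsMultiplication A h) (r : ℂ) : IsMultiplication (r • A) fun z => r * h z where
  eval := fun g z hz => by
    rw [smul_apply, eval₁_smul, hA.eval g z hz, mul_assoc]
  continuous := continuous_const.mul hA.continuous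
  boundary := fun g => by
    rw [smul_apply, map_smul]
    filter_upwards [MeasureTheory.Lp.coeFn_smul r (BidiskModel.boundary (A g)), hA.boundary g]
      with x h1 h2
    rw [h1, Pi.smul_apply, h2, smul_eq_mul, mul_assoc]

theorem add (hA : IsMultiplication A h) (hB : IsMultiplication B k) :
    IsMultiplication (A + B) fun z => h z + k z where
  eval := fun g z hz => by
    rw [add_apply, eval₁_add _ _ hz, hA.eval g z hz, hB.eval g z hz, add_mul]
  continuous := hA.continuous.add hB.continuous
  boundary := fun g => by
    rw [add_apply, map_add]
    filter_upwards [MeasureTheory.Lp.coeFn_add (BidiskModel.boundary (A g))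
      (BidiskModel.boundary (B g)), hA.boundary g, hB.boundary g] with x h1 h2 h3
    rw [h1, Pi.add_apply, h2, h3, add_mul]

theorem mul (hA : IsMultiplication A h) (hB : IsMultiplication B k) :
    IsMultiplication (A * B) fun z => h z * k z where
  eval := fun g z hz => by
    rw [mul_apply_eq_comp, hA.eval _ z hz, hB.eval g z hz, mul_assoc]
  continuous := hA.continuous.mul hB.continuous
  boundary := fun g => by
    rw [mul_apply_eq_comp]
    filter_upwards [hA.boundary (B g), hB.boundary g] with x h1 h2
    rw [h1, h2, mul_assoc]

theorem inv (hA : IsMultiplication A h) (hAB : A * B = 1) (h0 : ∀ z : ℂ, ‖z‖ ≤ 1 → h z ≠ 0) :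
    IsMultiplication B fun z => (h z)⁻¹ where
  eval := fun g z hz => by
    have := hA.eval (B g) z hz
    rw [← mul_apply_eq_comp, hAB] at this
    rw [show eval₁ g z = h z * eval₁ (B g) z from this, inv_mul_cancel_left₀ (h0 z (le_of_lt hz))]
  continuous := hA.continuous.inv₀ fun x => h0 _ (norm_toCircle x).le
  boundary := fun g => by
    have := hA.boundary (B g)
    rw [← mul_apply_eq_comp, hAB] at this
    filter_upwards [this] with x hx
    rw [show BidiskModel.boundary g x = _ from hx, inv_mul_cancel_left₀ (h0 _ (norm_toCircle x).le)]

theorem congr (hA : IsMultiplication A h) (hhk : ∀ z : ℂ, ‖z‖ ≤ 1 → h z = k z) :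
    IsMultiplication A k := by
  have h1 : ∀ x : AddCircle (1 : ℝ), h (AddCircle.toCircle x) = k (AddCircle.toCircle x) :=
    fun x => hhk _ (norm_toCircle x).le
  exact ⟨fun g z hz => by rw [hA.eval g z hz, hhk z (le_of_lt hz)],
    by simpa only [h1] using hA.continuous, fun g => by simpa only [h1] using hA.boundary g⟩

theorem exists_prod {ι : Type*} (s : Finset ι) {h : ι → ℂ → ℂ}
    (hh : ∀ i ∈ s, ∃ A, IsMultiplication A (h i)) :
    ∃ A, IsMultiplication A fun z => ∏ i ∈ s, h i z := by
  classical
  induction s using Finset.induction_on with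
  | empty => exact ⟨1, by simpa using one⟩
  | insert i s hi ih =>
    obtain ⟨A, hA⟩ := hh i (Finset.mem_insert_self i s)
    obtain ⟨B, hB⟩ := ih fun j hj => hh j (Finset.mem_insert_of_mem hj)
    exact ⟨A * B, by simpa [Finset.prod_insert hi] using hA.mul hB⟩

/-- The Toeplitz operator with symbol `h̄` is the adjoint of multiplication by `h`. -/
theorem toeplitzScalar_eq (hA : IsMultiplication A h) {φ : LInftyCircle}
    (hφ : φ =ᵐ[AddCircle.haarAddCircle]
      fun x : AddCircle (1 : ℝ) => conj (h (AddCircle.toCircle x))) :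
    toeplitzScalar φ = ContinuousLinearMap.adjoint A := by
  ext1 f
  refine ext_inner_right ℂ fun g => ?_
  rw [toeplitzScalar, ContinuousLinearMap.comp_apply, ContinuousLinearMap.comp_apply,
    ContinuousLinearMap.adjoint_inner_left, ContinuousLinearMap.adjoint_inner_left,
    ← inner_boundary f, MeasureTheory.L2.inner_def, MeasureTheory.L2.inner_def]
  refine MeasureTheory.integral_congr_ae ?_
  filter_upwards [hφ, hA.boundary g, coeFn_mulLInfty φ (BidiskModel.boundary f)] with x h1 h2 h3
  rw [h3, h1, h2]
  simp only [RCLike.inner_apply, map_mul, Complex.conj_conj]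
  ring

end IsMultiplication

/-! ### Uniqueness of the Toeplitz symbol -/

/-- The matrix entry of a Toeplitz operator is the Fourier coefficient of index n - k of its symbol.
-/
theorem inner_toeplitzScalar_single (φ : LInftyCircle) (n k : ℕ) :
    ⟪(lp.single 2 n (1 : ℂ) : H2Disk), toeplitzScalar φ (lp.single 2 k (1 : ℂ))⟫_ℂ =
      ⟪(fourierLp 2 ((n : ℤ) - k) : L2Circle),
        mulLInfty φ (fourierLp 2 (0 : ℤ))⟫_ℂ := by
  rw [toeplitzScalar, ContinuousLinearMap.comp_apply, ContinuousLinearMap.comp_apply,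
    ContinuousLinearMap.adjoint_inner_right, boundary_single, boundary_single,
    MeasureTheory.L2.inner_def, MeasureTheory.L2.inner_def]
  refine MeasureTheory.integral_congr_ae ?_
  filter_upwards [coeFn_mulLInfty φ (fourierLp 2 (k : ℤ)), coeFn_mulLInfty φ (fourierLp 2 (0 : ℤ)),
    coeFn_fourierLp (T := (1 : ℝ)) 2 (n : ℤ), coeFn_fourierLp (T := (1 : ℝ)) 2 (k : ℤ),
    coeFn_fourierLp (T := (1 : ℝ)) 2 (0 : ℤ), coeFn_fourierLp (T := (1 : ℝ)) 2 ((n : ℤ) - k)]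
    with x h1 h2 h3 h4 h5 h6
  rw [h1, h2, h3, h4, h5, h6, fourier_zero, sub_eq_add_neg, fourier_add, fourier_neg]
  simp only [RCLike.inner_apply, map_mul, Complex.conj_conj]
  ring

/-- Every integer is a difference n - k of naturals, so the operator determines all Fourier
coefficients of φ · 1. -/
theorem toeplitzScalar_injective : Function.Injective toeplitzScalar := by
  intro φ ψ h
  have h1 : mulLInfty φ (fourierLp 2 (0 : ℤ)) = mulLInfty ψ (fourierLp 2 (0 : ℤ)) := by
    refine (fourierBasis (T := (1 : ℝ))).repr.injective ?_
    ext n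
    rw [HilbertBasis.repr_apply_apply, HilbertBasis.repr_apply_apply, coe_fourierBasis]
    obtain ⟨j, k, rfl⟩ : ∃ j k : ℕ, (j : ℤ) - k = n := ⟨n.toNat, (-n).toNat, by omega⟩
    rw [← inner_toeplitzScalar_single, ← inner_toeplitzScalar_single, h]
  refine MeasureTheory.Lp.ext ?_
  have h2 := coeFn_mulLInfty φ (fourierLp 2 (0 : ℤ))
  rw [h1] at h2
  filter_upwards [h2, coeFn_mulLInfty ψ (fourierLp 2 (0 : ℤ)),
    coeFn_fourierLp (T := (1 : ℝ)) 2 (0 : ℤ)] with x h3 h4 h5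
  rw [h3, h5, fourier_zero, mul_one, mul_one] at h4
  exact h4

theorem toeplitz_apply {m : ℕ} (F : Matrix (Fin m) (Fin m) LInftyCircle) (g : H2DiskVec m)
    (j : Fin m) : toeplitz F g j = ∑ i, toeplitzScalar (F j i) (g i) := by
  simp [toeplitz]

theorem toeplitz_injective {m : ℕ} :
    Function.Injective (toeplitz : Matrix (Fin m) (Fin m) LInftyCircle → _) := by
  intro F F' h
  ext1 j i
  refine toeplitzScalar_injective (ContinuousLinearMap.ext fun g => ?_)
  have := congrArg (fun A : H2DiskVec m →L[ℂ] H2DiskVec m => A (PiLp.single 2 i g) j) h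
  simp only [toeplitz_apply] at this
  rw [Finset.sum_eq_single i, Finset.sum_eq_single i] at this
  · simpa using this
  all_goals simp +contextual

/-! ### Purity of the shifts -/

theorem isPure_shift : IsPure shift := by
  have key : ∀ n k, k < n → ∀ y, (shift ^ n) y k = 0 := by
    intro n
    induction n with
    | zero => exact fun k hk => absurd hk (Nat.not_lt_zero k)
    | succ n ih =>
      intro k hk y
      rw [pow_succ', mul_apply_eq_comp]
      rcases k with _ | k
      · exact shift_apply_zero _
      · rw [shift_apply_succ, ih k (by omega)]
  intro x hx
  ext k
  obtain ⟨y, rfl⟩ := hx (k + 1)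
  rw [key (k + 1) k (Nat.lt_succ_self k)]; rfl

theorem isPure_mulZ₁ : IsPure mulZ₁ := by
  have key : ∀ n j k, j < n → ∀ y, (mulZ₁ ^ n) y (j, k) = 0 := by
    intro n
    induction n with
    | zero => exact fun j _ hj => absurd hj (Nat.not_lt_zero j)
    | succ n ih =>
      intro j k hj y
      rw [pow_succ', mul_apply_eq_comp]
      rcases j with _ | j
      · exact mulZ₁_apply_zero _ k
      · rw [mulZ₁_apply_succ, ih j k (by omega)]
  intro x hx
  ext ⟨j, k⟩
  obtain ⟨y, rfl⟩ := hx (j + 1)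
  rw [key (j + 1) j k (Nat.lt_succ_self j)]; rfl

theorem commute_mulZ : Commute mulZ₁ mulZ₂ := by
  refine ContinuousLinearMap.ext fun F => eval₂_injective fun z hz => ?_
  rw [mul_apply_eq_comp, mul_apply_eq_comp, eval₂_mulZ₁ _ hz, eval₂_mulZ₂ _ hz,
    eval₂_mulZ₂ _ hz, eval₂_mulZ₁ _ hz]
  ring

/-- V - t = -t(1 - t̄V), with t̄ in the role of the contraction C. -/
theorem IsPure.denseRange_sub {X : Type*} [NormedAddCommGroup X] [InnerProductSpace ℂ X]
    [CompleteSpace X] {V : X →L[ℂ] X} (hp : IsPure V) (hV : ∀ x, ‖V x‖ = ‖x‖) {t : ℂ}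
    (ht : ‖t‖ = 1) : DenseRange (V - t • 1 : X →L[ℂ] X) := by
  have h1 := hp.denseRange_one_sub hV (C := conj t • 1) (fun x => by
    rw [smul_apply, norm_smul, RCLike.norm_conj, ht, one_mul]; rfl)
    ((Commute.one_right V).smul_right _)
  have htt : t * conj t = 1 := by rw [RCLike.mul_conj, ht]; norm_num
  have hs : Function.Surjective fun x : X => (-t) • x := fun x =>
    ⟨(-conj t) • x, by simp only [smul_smul, neg_mul_neg, htt, one_smul]⟩
  convert hs.denseRange.comp h1 (continuous_const_smul (-t)) using 1
  ext x
  simp only [Function.comp_apply, sub_apply, mul_apply_eq_comp, smul_apply, one_apply_eq_self,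
    smul_sub, smul_smul, neg_mul, htt]
  rw [neg_smul, neg_smul, one_smul, sub_neg_eq_add, neg_add_eq_sub]

/-! ### Polynomials in commuting isometries; multiplication by f and by θ -/

namespace BiAffine

variable {p : BiAffine} {l t : ℂ}

/-- Substitution of two operators for the variables of `p`. -/
def operator {X : Type*} [NormedAddCommGroup X] [InnerProductSpace ℂ X] (p : BiAffine)
    (V W : X →L[ℂ] X) : X →L[ℂ] X :=
  p.a • 1 + p.b • V + p.c • W + p.d • (V * W)

section

variable {X : Type*} [NormedAddCommGroup X] [InnerProductSpace ℂ X] {V W : X →L[ℂ] X}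

theorem operator_apply (x : X) :
    p.operator V W x = p.a • x + p.b • V x + p.c • W x + p.d • V (W x) := rfl

variable [CompleteSpace X]

/-- The operator form of |p̃| = |p| on the torus. Inner products of monomials in V and W applied to
x are unchanged when a common isometry is cancelled, so reversing exponents and conjugating
coefficients only permutes the terms of the squared norm. -/
theorem norm_operator_tilde (hV : ∀ x, ‖V x‖ = ‖x‖) (hW : ∀ x, ‖W x‖ = ‖x‖)
    (hVW : Commute V W) (x : X) : ‖p.tilde.operator V W x‖ = ‖p.operator V W x‖ := by
  have hc : V (W x) = W (V x) := by rw [← mul_apply_eq_comp, hVW.eq, mul_apply_eq_comp]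
  have e1 : ⟪W x, V (W x)⟫_ℂ = ⟪x, V x⟫_ℂ := by rw [hc, inner_map_map hW]
  have e2 : ⟪V (W x), W x⟫_ℂ = ⟪V x, x⟫_ℂ := by rw [hc, inner_map_map hW]
  rw [← sq_eq_sq₀ (norm_nonneg _) (norm_nonneg _)]
  apply Complex.ofReal_injective
  push_cast
  rw [← Complex.coe_algebraMap]
  erw [← inner_self_eq_norm_sq_to_K (𝕜 := ℂ), ← inner_self_eq_norm_sq_to_K (𝕜 := ℂ)]
  simp only [operator_apply, tilde, inner_add_left, inner_add_right, inner_smul_left,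
    inner_smul_right, inner_map_map hV, inner_map_map hW, e1, e2, Complex.conj_conj]
  ring

/-- The operator form of |A|² = |B|² + |l(z - t)|² on the circle. -/
theorem Regular.norm_sq_apply (h : p.Regular l t) (hV : ∀ x, ‖V x‖ = ‖x‖) (x : X) :
    ‖p.a • x + p.c • V x‖ ^ 2 = ‖p.b • x + p.d • V x‖ ^ 2 + ‖l • (V x - t • x)‖ ^ 2 := by
  apply Complex.ofReal_injective
  push_cast
  rw [← Complex.coe_algebraMap]
  erw [← inner_self_eq_norm_sq_to_K (𝕜 := ℂ), ← inner_self_eq_norm_sq_to_K (𝕜 := ℂ),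
    ← inner_self_eq_norm_sq_to_K (𝕜 := ℂ)]
  simp only [inner_add_left, inner_add_right, inner_smul_left, inner_sub_left, inner_sub_right,
    inner_smul_right, inner_map_map hV]
  have e1 := h.sq_eq
  have e3 := h.sq_eq'
  have e4 := congrArg conj e1
  have e5 := congrArg conj e3
  simp only [map_pow, map_sub, map_mul, map_neg, Complex.conj_conj] at e4 e5
  linear_combination ⟪x, x⟫_ℂ * h.norm_sum - ⟪x, x⟫_ℂ * l * conj l * h.t_mul_conj +
    ⟪x, V x⟫_ℂ * (e3 - e1) + ⟪V x, x⟫_ℂ * (e5 - e4)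

theorem Regular.norm_sq_apply_inverse (h : p.Regular l t) (hV : ∀ x, ‖V x‖ = ‖x‖)
    {R : X →L[ℂ] X} (hR : (p.a • 1 + p.c • V) * R = 1) (x : X) :
    ‖x‖ ^ 2 = ‖(-((p.b • 1 + p.d • V) * R)) x‖ ^ 2 + ‖(l • ((V - t • 1) * R)) x‖ ^ 2 := by
  have h1 : p.a • R x + p.c • V (R x) = x := congrArg (fun A : X →L[ℂ] X => A x) hR
  have := h.norm_sq_apply hV (R x)
  rw [h1] at this
  rw [this, neg_apply, norm_neg]
  rfl

/-- p(V, W) = (1 - ψ(W)V)A(W), where A(W) is invertible and ψ(W) = -B(W)A(W)⁻¹ is a contraction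
commuting with the pure isometry V. -/
theorem Regular.denseRange_operator (h : p.Regular l t) (hV : ∀ x, ‖V x‖ = ‖x‖)
    (hW : ∀ x, ‖W x‖ = ‖x‖) (hVW : Commute V W) (hp : IsPure V) :
    DenseRange (p.operator V W) := by
  obtain ⟨R, hR, hR', hWR⟩ := exists_inverse_affine hW h.norm_c_lt
  have hVD : Commute V (p.a • 1 + p.c • W) :=
    ((Commute.one_right V).smul_right _).add_right (hVW.smul_right _)
  have hVN : Commute V (p.b • 1 + p.d • W) :=
    ((Commute.one_right V).smul_right _).add_right (hVW.smul_right _)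
  have hVR : Commute V R := by
    calc V * R = (R * (p.a • 1 + p.c • W)) * V * R := by rw [hR', one_mul]
      _ = R * (V * (p.a • 1 + p.c • W)) * R := by rw [mul_assoc R, hVD.eq]
      _ = R * V * ((p.a • 1 + p.c • W) * R) := by simp only [mul_assoc]
      _ = R * V := by rw [hR, mul_one]
  have hle : ∀ x, ‖(-((p.b • 1 + p.d • W) * R)) x‖ ≤ ‖x‖ := fun x => by
    refine le_of_sq_le_sq ?_ (norm_nonneg _)
    rw [h.norm_sq_apply_inverse hW hR x]
    exact le_add_of_nonneg_right (sq_nonneg _)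
  have h1 := hp.denseRange_one_sub hV hle ((hVN.mul_right hVR).neg_right)
  have hs : Function.Surjective (p.a • 1 + p.c • W : X →L[ℂ] X) := fun x =>
    ⟨R x, congrArg (fun A : X →L[ℂ] X => A x) hR⟩
  have h2 := h1.comp hs.denseRange (ContinuousLinearMap.continuous _)
  have heq : p.operator V W =
      (1 - (-((p.b • 1 + p.d • W) * R)) * V) * (p.a • 1 + p.c • W) := by
    have : (p.b • 1 + p.d • W) * R * V * (p.a • 1 + p.c • W) = (p.b • 1 + p.d • W) * V := by
      rw [mul_assoc, hVD.eq, mul_assoc, ← mul_assoc R, hR', one_mul]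
    rw [neg_mul, sub_neg_eq_add, add_mul, one_mul, this, ← hVN.eq, operator, mul_add,
      mul_smul_comm, mul_smul_comm, mul_one]
    abel
  rw [heq]
  exact h2

end

theorem eval₂_operator (p : BiAffine) (F : H2Bidisk) {z : ℂ × ℂ} (hz : z ∈ bidisk) :
    eval₂ (p.operator mulZ₁ mulZ₂ F) z = p.eval z * eval₂ F z := by
  rw [operator_apply, eval₂_add _ _ hz, eval₂_add _ _ hz, eval₂_add _ _ hz]
  simp only [eval₂_smul, eval₂_mulZ₁ _ hz, eval₂_mulZ₂ _ hz, eval]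
  ring

namespace Regular

theorem exists_inverse (h : p.Regular l t) :
    ∃ R, IsMultiplication R (fun z => (p.a + p.c * z)⁻¹) ∧ (p.a • 1 + p.c • shift) * R = 1 ∧
      R * (p.a • 1 + p.c • shift) = 1 ∧ Commute shift R := by
  obtain ⟨R, hR, hR', hc⟩ := exists_inverse_affine norm_shift h.norm_c_lt
  have hD : IsMultiplication (p.a • 1 + p.c • shift) fun z => p.a * 1 + p.c * z :=
    (IsMultiplication.one.smul _).add (IsMultiplication.shift.smul _)
  refine ⟨R, ?_, hR, hR', hc⟩
  have := hD.inv hR fun z hz => by rw [mul_one]; exact h.denom_ne_zero hz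
  simpa using this

theorem exists_zeta (h : p.Regular l t) : ∃ A, IsMultiplication A p.zeta := by
  obtain ⟨R, hR, -⟩ := h.exists_inverse
  refine ⟨_, (((IsMultiplication.shift.smul (conj p.b)).add
    (IsMultiplication.one.smul (conj p.d))).mul hR).congr fun z _ => ?_⟩
  rw [zeta, div_eq_mul_inv, mul_one]

/-- Multiplication by `ψ` and `φ`, with `|φ|² + |ψ|² = 1` on the circle. -/
theorem exists_psi_phi (h : p.Regular l t) :
    ∃ Ψ Φ, IsMultiplication Ψ p.psi ∧ IsMultiplication Φ (p.phi l t) ∧ Commute Ψ Φ ∧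
      (∀ x, ‖x‖ ^ 2 = ‖Ψ x‖ ^ 2 + ‖Φ x‖ ^ 2) ∧ DenseRange Φ := by
  obtain ⟨R, hRm, hR, hR', hc⟩ := h.exists_inverse
  have hΨ : IsMultiplication (-((p.b • 1 + p.d • shift) * R)) p.psi := by
    have := (((IsMultiplication.one.smul p.b).add
      (IsMultiplication.shift.smul p.d)).mul hRm).smul (-1)
    rw [neg_one_smul] at this
    refine this.congr fun z _ => ?_
    rw [psi, div_eq_mul_inv, mul_one, neg_one_mul]
  have hΦ : IsMultiplication (l • ((shift - t • 1) * R)) (p.phi l t) := by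
    have := ((IsMultiplication.shift.add (IsMultiplication.one.smul (-t))).mul hRm).smul l
    rw [neg_smul, ← sub_eq_add_neg] at this
    refine this.congr fun z _ => ?_
    rw [phi, div_eq_mul_inv, mul_one, sub_eq_add_neg]
  refine ⟨_, _, hΨ, hΦ, ?_, h.norm_sq_apply_inverse norm_shift hR, ?_⟩
  · refine ContinuousLinearMap.ext fun g => eval₁_injective fun z hz => ?_
    rw [mul_apply_eq_comp, mul_apply_eq_comp, hΨ.eval _ z hz, hΦ.eval _ z hz, hΦ.eval _ z hz,
      hΨ.eval _ z hz]
    ring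
  -- Multiplication by z - t has dense range although t is on the circle; 1/A and l are invertible.
  · have h1 := isPure_shift.denseRange_sub norm_shift h.norm_t
    have hs : Function.Surjective R := fun x =>
      ⟨(p.a • 1 + p.c • shift) x, congrArg (fun A : H2Disk →L[ℂ] H2Disk => A x) hR'⟩
    have h2 := h1.comp hs.denseRange (ContinuousLinearMap.continuous _)
    have hl : Function.Surjective fun x : H2Disk => l • x := fun x =>
      ⟨l⁻¹ • x, by simp only [smul_smul, mul_inv_cancel₀ h.l_ne_zero, one_smul]⟩
    exact hl.denseRange.comp h2 (continuous_const_smul l)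

/-- Multiplication by `f` is an isometry of `H²(𝔻)` into `H²(𝔻²)`. -/
theorem exists_isometry_reproducing (h : p.Regular l t) :
    ∃ E : H2Disk →ₗᵢ[ℂ] H2Bidisk, ∀ g, ∀ z ∈ bidisk,
      eval₂ (E g) z = p.reproducing l t z * eval₁ g z.2 := by
  obtain ⟨Ψ, Φ, hΨ, hΦ, hc, hn, hd⟩ := h.exists_psi_phi
  have hsum := hasSum_norm_sq_pow hc hn hd
  -- The expansion fg = ∑ z₁ⁿψⁿφg serves as the definition.
  let L : H2Disk →ₗ[ℂ] H2Bidisk :=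
    { toFun := fun g => ofSlices (fun n => (Ψ ^ n) (Φ g)) (hsum g).summable
      map_add' := fun f g => by
        ext n
        change (Ψ ^ n.1) (Φ (f + g)) n.2 = (Ψ ^ n.1) (Φ f) n.2 + (Ψ ^ n.1) (Φ g) n.2
        rw [map_add, map_add]; rfl
      map_smul' := fun r g => by
        ext n
        change (Ψ ^ n.1) (Φ (r • g)) n.2 = r * (Ψ ^ n.1) (Φ g) n.2
        rw [map_smul, map_smul]; rfl }
  refine ⟨⟨L, fun g => ?_⟩, fun g z hz => ?_⟩
  · rw [← sq_eq_sq₀ (norm_nonneg _) (norm_nonneg _)]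
    exact (norm_sq_ofSlices _ (hsum g).summable).unique (hsum g)
  · have hpow : ∀ (n : ℕ) (x : H2Disk), eval₁ ((Ψ ^ n) x) z.2 = p.psi z.2 ^ n * eval₁ x z.2 := by
      intro n
      induction n with
      | zero => simp
      | succ n ih =>
        intro x
        rw [pow_succ', mul_apply_eq_comp, hΨ.eval _ _ hz.2, ih, pow_succ']
        ring
    have h1 := hasSum_slice (L g) hz
    have h2 : (fun j => eval₁ (slice (L g) j) z.2 * z.1 ^ j) =
        fun j => (p.psi z.2 * z.1) ^ j * (p.phi l t z.2 * eval₁ g z.2) := by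
      ext j
      have : slice (L g) j = (Ψ ^ j) (Φ g) := rfl
      rw [this, hpow, hΦ.eval _ _ hz.2, mul_pow]
      ring
    rw [h2] at h1
    have h3 := h.reproducing_sub hz
    change eval₂ (L g) z = _
    -- The bound |ψ(z₂)z₁| < 1 needed to sum the geometric series is read off from its convergence,
    -- which says nothing when φg vanishes at z₂; there both sides are 0.
    rcases eq_or_ne (p.phi l t z.2 * eval₁ g z.2) 0 with h0 | h0
    · simp only [h0, mul_zero] at h1
      rw [h1.unique hasSum_zero]
      rcases mul_eq_zero.1 h0 with h0 | h0
      · have : z.2 - t = 0 := by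
          simpa [phi, h.l_ne_zero, h.denom_ne_zero (le_of_lt hz.2)] using h0
        rw [reproducing, this, mul_zero, zero_div, zero_mul]
      · rw [h0, mul_zero]
    · have h4 := (summable_mul_right_iff h0).1 h1.summable
      have h5 := summable_geometric_iff_norm_lt_one.1 h4
      rw [h1.unique ((hasSum_geometric_of_norm_lt_one h5).mul_right _)]
      have h6 : 1 - p.psi z.2 * z.1 ≠ 0 := fun h6 => by
        rw [← sub_eq_zero.1 h6, norm_one] at h5
        exact lt_irrefl _ h5
      rw [← mul_assoc]
      congr 1
      rw [inv_mul_eq_iff_eq_mul₀ h6]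
      linear_combination -h3

/-- Multiplication by the inner function `p̃ / p` is an isometry of `H²(𝔻²)`. -/
theorem exists_isometry_inner (h : p.Regular l t) :
    ∃ T : H2Bidisk →ₗᵢ[ℂ] H2Bidisk, ∀ F, ∀ z ∈ bidisk, eval₂ (T F) z = p.inner z * eval₂ F z := by
  have hd : DenseRange (p.operator mulZ₁ mulZ₂).toLinearMap :=
    h.denseRange_operator norm_mulZ₁ norm_mulZ₂ commute_mulZ isPure_mulZ₁
  have hn : ∀ F, ‖p.tilde.operator mulZ₁ mulZ₂ F‖ = ‖p.operator mulZ₁ mulZ₂ F‖ :=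
    norm_operator_tilde norm_mulZ₁ norm_mulZ₂ commute_mulZ
  -- The continuous extension of pF ↦ p̃F from the dense subspace pH².
  let T : H2Bidisk →L[ℂ] H2Bidisk := LinearMap.extendOfNorm
    (p.tilde.operator mulZ₁ mulZ₂).toLinearMap (p.operator mulZ₁ mulZ₂).toLinearMap
  have hT : ∀ F, T (p.operator mulZ₁ mulZ₂ F) = p.tilde.operator mulZ₁ mulZ₂ F := fun F =>
    LinearMap.extendOfNorm_eq hd ⟨1, fun F => by rw [one_mul]; exact (hn F).le⟩ F
  refine ⟨⟨T.toLinearMap, fun F => ?_⟩, fun F z hz => ?_⟩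
  · refine hd.induction_on (p := fun F => ‖T F‖ = ‖F‖) F
      (isClosed_eq (by fun_prop) (by fun_prop)) fun G => ?_
    exact (congrArg norm (hT G)).trans (hn G)
  · refine hd.induction_on (p := fun F => eval₂ (T F) z = p.inner z * eval₂ F z) F
      (isClosed_eq ((continuous_eval₂ hz).comp T.continuous)
        (continuous_const.mul (continuous_eval₂ hz))) fun G => ?_
    change eval₂ (T (p.operator mulZ₁ mulZ₂ G)) z = p.inner z * eval₂ (p.operator mulZ₁ mulZ₂ G) z
    rw [hT, eval₂_operator _ _ hz, eval₂_operator _ _ hz, inner, ← mul_assoc,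
      div_mul_cancel₀ _ (h.eval_ne_zero z hz)]

/-- `S_{2,θ}` is orthogonal to `θ H²(𝔻²)`. -/
theorem inner_eq_zero (h : p.Regular l t) {f F G : H2Bidisk} {g : H2Disk}
    (hf : ∀ z ∈ bidisk, eval₂ f z = p.reproducing l t z * eval₁ g z.2)
    (hG : ∀ z ∈ bidisk, eval₂ G z = p.inner z * eval₂ F z) : ⟪f, G⟫_ℂ = 0 := by
  obtain ⟨T, hT⟩ := h.exists_isometry_inner
  obtain rfl : G = T F := eval₂_injective fun z hz => by rw [hG z hz, hT F z hz]
  -- The product of p with this element is l(z₂ - t)g(z₂), which does not involve z₁, so its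
  -- backward shift in z₁ is 0.
  have hrel : p.a • ContinuousLinearMap.adjoint mulZ₁ f +
      p.c • mulZ₂ (ContinuousLinearMap.adjoint mulZ₁ f) + p.b • f + p.d • mulZ₂ f = 0 := by
    refine mulZ₁_injective (eval₂_injective fun z hz => ?_)
    have h1 := mul_eval₂_adjoint_mulZ₁ f hz
    rw [hf z hz, hf _ (mem_bidisk_fst_zero hz)] at h1
    have h2 : p.reproducing l t z * p.eval z = l * (z.2 - t) :=
      div_mul_cancel₀ _ (h.eval_ne_zero z hz)
    have h3 : p.reproducing l t (0, z.2) * p.eval (0, z.2) = l * (z.2 - t) :=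
      div_mul_cancel₀ _ (h.eval_ne_zero _ (mem_bidisk_fst_zero hz))
    rw [eval₂_mulZ₁ _ hz, map_zero, eval₂_zero, eval₂_add _ _ hz, eval₂_add _ _ hz,
      eval₂_add _ _ hz]
    simp only [eval₂_smul, eval₂_mulZ₂ _ hz, hf z hz]
    simp only [eval] at h2 h3
    linear_combination (p.a + p.c * z.2) * h1 + eval₁ g z.2 * h2 - eval₁ g z.2 * h3
  have hd := h.denseRange_operator norm_mulZ₁ norm_mulZ₂ commute_mulZ isPure_mulZ₁
  refine hd.induction_on (p := fun F => ⟪f, T F⟫_ℂ = 0) F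
    (isClosed_eq (continuous_const.inner T.continuous) continuous_const) fun G => ?_
  have hTG : T (p.operator mulZ₁ mulZ₂ G) = p.tilde.operator mulZ₁ mulZ₂ G :=
    eval₂_injective fun z hz => by
      rw [hT _ z hz, eval₂_operator _ _ hz, eval₂_operator _ _ hz, BiAffine.inner, ← mul_assoc,
        div_mul_cancel₀ _ (h.eval_ne_zero z hz)]
  rw [hTG, operator_apply]
  -- Pairing with z₂G instead of G turns the conjugated coefficients of p into those of p̃, each at
  -- the right monomial.
  have h0 : ⟪p.a • ContinuousLinearMap.adjoint mulZ₁ f +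
      p.c • mulZ₂ (ContinuousLinearMap.adjoint mulZ₁ f) + p.b • f + p.d • mulZ₂ f, mulZ₂ G⟫_ℂ
        = 0 := by rw [hrel, inner_zero_left]
  simp only [inner_add_left, inner_smul_left, inner_map_map norm_mulZ₂,
    ContinuousLinearMap.adjoint_inner_left] at h0
  simp only [tilde, inner_add_right, inner_smul_right]
  linear_combination h0

end Regular

end BiAffine

/-! ### The reproducing kernel of f H²(𝔻) -/

theorem snd_mem_disk {z : ℂ × ℂ} (hz : z ∈ bidisk) : z.2 ∈ disk := hz.2

/-- `S_{2,θ} = f H²(𝔻)`. -/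
theorem BiAffine.S₂_eq {p : BiAffine} {l t : ℂ} {E : H2Disk →ₗᵢ[ℂ] H2Bidisk}
    (hE : ∀ g, ∀ z ∈ bidisk, eval₂ (E g) z = p.reproducing l t z * eval₁ g z.2) :
    p.S₂ l t = LinearMap.range E.toLinearMap ∧
      IsReproducingKernelSpace (p.S₂ l t) (p.kernel l t) := by
  have hk : ∀ w (hw : w ∈ bidisk), ∀ z ∈ bidisk,
      eval₂ (E (conj (p.reproducing l t w) • szego w.2 (snd_mem_disk hw))) z = p.kernel l t z w := by
    intro w hw z hz
    rw [hE _ z hz, eval₁_smul, eval₁_szego (snd_mem_disk hw) (snd_mem_disk hz), kernel, div_eq_mul_inv, mul_assoc]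
  have hi : ∀ w (hw : w ∈ bidisk), ∀ g,
      ⟪E (conj (p.reproducing l t w) • szego w.2 (snd_mem_disk hw)), E g⟫_ℂ = eval₂ (E g) w := by
    intro w hw g
    rw [LinearIsometry.inner_map_map, inner_smul_left, inner_szego, Complex.conj_conj, hE g w hw]
  have hclosed : IsClosed (LinearMap.range E.toLinearMap : Set H2Bidisk) :=
    E.isometry.isClosedEmbedding.isClosed_range
  have hS : p.S₂ l t = LinearMap.range E.toLinearMap := by
    refine le_antisymm ?_ ?_
    · refine Submodule.topologicalClosure_minimal _ (Submodule.span_le.2 ?_) hclosed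
      rintro F ⟨w, hw, hF⟩
      exact ⟨_, eval₂_injective fun z hz => (hk w hw z hz).trans (hF z hz).symm⟩
    · set K := p.S₂ l t with hK
      have hKc : IsClosed (K : Set H2Bidisk) := Submodule.isClosed_topologicalClosure _
      have : CompleteSpace K := hKc.completeSpace_coe
      have hKE : K ≤ LinearMap.range E.toLinearMap := by
        refine Submodule.topologicalClosure_minimal _ (Submodule.span_le.2 ?_) hclosed
        rintro F ⟨w, hw, hF⟩
        exact ⟨_, eval₂_injective fun z hz => (hk w hw z hz).trans (hF z hz).symm⟩
      -- An element of the range orthogonal to every kernel function vanishes at every point, so the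
      -- kernels span the range.
      rw [← Submodule.sup_orthogonal_inf_of_hasOrthogonalProjection hKE]
      refine sup_le le_rfl ?_
      rintro F ⟨hF, g, rfl⟩
      have h0 : E g = 0 := eval₂_injective fun w hw => by
        rw [eval₂_zero, ← hi w hw]
        exact (Submodule.mem_orthogonal _ _).1 hF _
          (Submodule.le_topologicalClosure _ (Submodule.subset_span ⟨w, hw, hk w hw⟩))
      change E g ∈ K
      rw [h0]
      exact K.zero_mem
  refine ⟨hS, ?_, fun w hw => ⟨E (conj (p.reproducing l t w) • szego w.2 (snd_mem_disk hw)), ?_, hk w hw, ?_⟩⟩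
  · rw [hS]; exact hclosed
  · rw [hS]; exact ⟨_, rfl⟩
  · rw [hS]
    rintro F ⟨g, rfl⟩
    exact hi w hw g

/-! ### Products of inner functions -/

section Products

variable {m : ℕ} {p : Fin m → BiAffine} {l t : Fin m → ℂ}

theorem exists_isometry_prod (h : ∀ i, (p i).Regular (l i) (t i)) (s : Finset (Fin m)) :
    ∃ T : H2Bidisk →ₗᵢ[ℂ] H2Bidisk, ∀ F, ∀ z ∈ bidisk,
      eval₂ (T F) z = (∏ k ∈ s, (p k).inner z) * eval₂ F z := by
  induction s using Finset.induction_on with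
  | empty => exact ⟨LinearIsometry.id, fun F z _ => by simp⟩
  | insert i s hi ih =>
    obtain ⟨T, hT⟩ := ih
    obtain ⟨T', hT'⟩ := (h i).exists_isometry_inner
    refine ⟨T'.comp T, fun F z hz => ?_⟩
    change eval₂ (T' (T F)) z = _
    rw [hT' _ z hz, hT F z hz, Finset.prod_insert hi, mul_assoc]

/-- The values of the basis functions `eᵢ`. -/
def basisValue (p : Fin m → BiAffine) (l t : Fin m → ℂ) (i : Fin m) (z : ℂ × ℂ) : ℂ :=
  partialProduct p i z * (p i).reproducing (l i) (t i) z

/-- The common factor θ₁ ⋯ θ_{i-1} acts isometrically, leaving the orthogonality of fᵢH²(𝔻) to θᵢH².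
-/
theorem inner_basis_eq_zero (h : ∀ i, (p i).Regular (l i) (t i)) {i : Fin m} {F G G' : H2Bidisk}
    {g : H2Disk} (hF : ∀ z ∈ bidisk, eval₂ F z = basisValue p l t i z * eval₁ g z.2)
    (hG : ∀ z ∈ bidisk, eval₂ G z = partialProduct p i z * ((p i).inner z * eval₂ G' z)) :
    ⟪F, G⟫_ℂ = 0 := by
  obtain ⟨T, hT⟩ := exists_isometry_prod h (Finset.Iio i)
  obtain ⟨E, hE⟩ := (h i).exists_isometry_reproducing
  obtain ⟨T', hT'⟩ := (h i).exists_isometry_inner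
  have h1 : F = T (E g) := eval₂_injective fun z hz => by
    rw [hF z hz, hT _ z hz, hE _ z hz, basisValue, partialProduct, mul_assoc]
  have h2 : G = T (T' G') := eval₂_injective fun z hz => by
    rw [hG z hz, hT _ z hz, hT' _ z hz, partialProduct]
  rw [h1, h2, LinearIsometry.inner_map_map]
  exact (h i).inner_eq_zero (hE g) (hT' G')

theorem partialProduct_eq (p : Fin m → BiAffine) {i j : Fin m} (hij : i < j) (z : ℂ × ℂ) :
    partialProduct p j z =
      partialProduct p i z * ((p i).inner z * ∏ k ∈ Finset.Ioo i j, (p k).inner z) := by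
  have h1 : Finset.Iio j = Finset.Iio i ∪ insert i (Finset.Ioo i j) := by
    ext k; simp only [Finset.mem_Iio, Finset.mem_union, Finset.mem_insert, Finset.mem_Ioo]; omega
  have h2 : Disjoint (Finset.Iio i) (insert i (Finset.Ioo i j)) := by
    rw [Finset.disjoint_left]; intro k
    simp only [Finset.mem_Iio, Finset.mem_insert, Finset.mem_Ioo]; omega
  rw [partialProduct, h1, Finset.prod_union h2, Finset.prod_insert (by simp), partialProduct]

theorem fullProduct_eq (p : Fin m → BiAffine) (i : Fin m) (z : ℂ × ℂ) :
    fullProduct p z =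
      partialProduct p i z * ((p i).inner z * ∏ k ∈ Finset.Ioi i, (p k).inner z) := by
  have h1 : Finset.univ = Finset.Iio i ∪ insert i (Finset.Ioi i) := by
    ext k; simpa using lt_or_ge k i
  have h2 : Disjoint (Finset.Iio i) (insert i (Finset.Ioi i)) := by
    rw [Finset.disjoint_left]; intro k
    simp only [Finset.mem_Iio, Finset.mem_insert, Finset.mem_Ioi]; omega
  rw [fullProduct, h1, Finset.prod_union h2, Finset.prod_insert (by simp), partialProduct]

/-- For i < j the factor θᵢ occurs in eⱼ. -/
theorem inner_basis_basis (h : ∀ i, (p i).Regular (l i) (t i)) {i j : Fin m} (hij : i ≠ j)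
    {F G : H2Bidisk} {f g : H2Disk}
    (hF : ∀ z ∈ bidisk, eval₂ F z = basisValue p l t i z * eval₁ f z.2)
    (hG : ∀ z ∈ bidisk, eval₂ G z = basisValue p l t j z * eval₁ g z.2) : ⟪F, G⟫_ℂ = 0 := by
  wlog hlt : i < j generalizing i j F G f g
  · exact inner_eq_zero_symm.1 (this hij.symm hG hF (lt_of_le_of_ne (not_lt.1 hlt) hij.symm))
  obtain ⟨T, hT⟩ := exists_isometry_prod h (Finset.Ioo i j)
  obtain ⟨E, hE⟩ := (h j).exists_isometry_reproducing
  refine inner_basis_eq_zero h hF (G' := T (E g)) fun z hz => ?_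
  rw [hG z hz, hT _ z hz, hE _ z hz, basisValue, partialProduct_eq p hlt]
  ring

theorem mem_summand_iff (h : ∀ i, (p i).Regular (l i) (t i)) {i : Fin m} {F : H2Bidisk} :
    F ∈ summand p l t i ↔
      ∃ g, ∀ z ∈ bidisk, eval₂ F z = basisValue p l t i z * eval₁ g z.2 := by
  obtain ⟨E, hE⟩ := (h i).exists_isometry_reproducing
  constructor
  · rintro ⟨G, hG, hF⟩
    rw [(BiAffine.S₂_eq hE).1] at hG
    obtain ⟨g, rfl⟩ := hG
    refine ⟨g, fun z hz => ?_⟩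
    rw [hF z hz, basisValue, mul_assoc]
    exact congrArg _ (hE g z hz)
  · rintro ⟨g, hg⟩
    refine ⟨E g, ?_, fun z hz => ?_⟩
    · rw [(BiAffine.S₂_eq hE).1]; exact ⟨g, rfl⟩
    · rw [hg z hz, hE g z hz, basisValue, mul_assoc]

theorem summand_isOrtho (h : ∀ i, (p i).Regular (l i) (t i)) {i j : Fin m} (hij : i ≠ j) :
    summand p l t i ⟂ summand p l t j := by
  rw [Submodule.isOrtho_iff_inner_eq]
  intro F hF G hG
  obtain ⟨f, hf⟩ := (mem_summand_iff h).1 hF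
  obtain ⟨g, hg⟩ := (mem_summand_iff h).1 hG
  exact inner_basis_basis h hij hf hg

/-- The isometry `(g₁, …, g_m) ↦ ∑ᵢ eᵢ gᵢ(z₂)`, with range `S₂`. -/
theorem exists_isometry_basis (h : ∀ i, (p i).Regular (l i) (t i)) :
    ∃ U : H2DiskVec m →ₗᵢ[ℂ] H2Bidisk,
      (∀ g, ∀ z ∈ bidisk, eval₂ (U g) z = ∑ i, basisValue p l t i z * eval₁ (g i) z.2) ∧
      LinearMap.range U.toLinearMap = productS₂ p l t := by
  choose E hE using fun i => (h i).exists_isometry_reproducing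
  choose T hT using fun i : Fin m => exists_isometry_prod h (Finset.Iio i)
  let W : Fin m → H2Disk →ₗᵢ[ℂ] H2Bidisk := fun i => (T i).comp (E i)
  have hW : ∀ i g, ∀ z ∈ bidisk, eval₂ (W i g) z = basisValue p l t i z * eval₁ g z.2 := by
    intro i g z hz
    change eval₂ (T i (E i g)) z = _
    rw [hT i _ z hz, hE i _ z hz, basisValue, partialProduct, mul_assoc]
  have hortho : OrthogonalFamily ℂ (fun _ : Fin m => H2Disk) W :=
    fun i j hij f g => inner_basis_basis h hij (hW i f) (hW j g)
  let L : H2DiskVec m →ₗ[ℂ] H2Bidisk :=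
    { toFun := fun g => ∑ i, W i (g i)
      map_add' := fun f g => by simp [Finset.sum_add_distrib]
      map_smul' := fun r g => by simp [Finset.smul_sum] }
  let U : H2DiskVec m →ₗᵢ[ℂ] H2Bidisk := ⟨L, fun g => by
    rw [← sq_eq_sq₀ (norm_nonneg _) (norm_nonneg _), PiLp.norm_sq_eq_of_L2]
    exact hortho.norm_sum (fun i => g i) Finset.univ⟩
  have hU : ∀ g, ∀ z ∈ bidisk, eval₂ (U g) z = ∑ i, basisValue p l t i z * eval₁ (g i) z.2 := by
    intro g z hz
    change eval₂ (∑ i, W i (g i)) z = _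
    rw [eval₂_sum _ _ hz]
    exact Finset.sum_congr rfl fun i _ => hW i _ z hz
  refine ⟨U, hU, le_antisymm ?_ ?_⟩
  · rintro _ ⟨g, rfl⟩
    have : ∑ i, W i (g i) ∈ ⨆ i, summand p l t i := Submodule.sum_mem _ fun i _ =>
      Submodule.mem_iSup_of_mem i ((mem_summand_iff h).2 ⟨g i, hW i _⟩)
    exact Submodule.le_topologicalClosure _ this
  · refine Submodule.topologicalClosure_minimal _ (iSup_le fun i F hF => ?_)
      U.isometry.isClosedEmbedding.isClosed_range
    obtain ⟨g, hg⟩ := (mem_summand_iff h).1 hF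
    refine ⟨PiLp.single 2 i g, eval₂_injective fun z hz => ?_⟩
    rw [hg z hz]
    refine (hU _ z hz).trans ?_
    rw [Finset.sum_eq_single i]
    · simp
    · intro j _ hj
      simp [hj, eval₁_zero]
    · simp

/-! ### The backward shift on `S₂` -/

/-- The function `h_{ij}` of the matrix of the backward shift `M_{z₁}*` on `S₂`. -/
def backwardEntry (p : Fin m → BiAffine) (l t : Fin m → ℂ) (i j : Fin m) (z : ℂ) : ℂ :=
  if i < j then
    (p j).phi (l j) (t j) z * (p i).phi (l i) (t i) z * ∏ k ∈ Finset.Ioo i j, (p k).zeta z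
  else if j = i then (p j).psi z else 0

theorem explicitSymbol_apply (z : ℂ) (i j : Fin m) :
    explicitSymbol p l t z j i = conj (backwardEntry p l t i j z) := by
  rw [explicitSymbol, Matrix.of_apply, backwardEntry]
  split_ifs with h1 h2
  · rfl
  · rw [h2]; rfl
  · simp

theorem exists_backwardEntry (h : ∀ i, (p i).Regular (l i) (t i)) (i j : Fin m) :
    ∃ A, IsMultiplication A (backwardEntry p l t i j) := by
  by_cases h1 : i < j
  · obtain ⟨_, A, _, hA, -⟩ := (h j).exists_psi_phi
    obtain ⟨_, B, _, hB, -⟩ := (h i).exists_psi_phi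
    obtain ⟨C, hC⟩ := IsMultiplication.exists_prod (Finset.Ioo i j)
      (h := fun k => (p k).zeta) fun k _ => (h k).exists_zeta
    exact ⟨_, ((hA.mul hB).mul hC).congr fun z _ => by rw [backwardEntry, if_pos h1]⟩
  · by_cases h2 : j = i
    · obtain ⟨A, _, hA, -⟩ := (h j).exists_psi_phi
      exact ⟨A, hA.congr fun z _ => by rw [backwardEntry, if_neg h1, if_pos h2]⟩
    · exact ⟨0, IsMultiplication.zero.congr fun z _ => by
        rw [backwardEntry, if_neg h1, if_neg h2]⟩

/-- The telescoping keeps f before i and g after i, so that with f = θ and g = ζ the terms are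
multiples of eᵢ by functions of z₂. -/
theorem prod_sub_prod_ordered {R : Type*} [CommRing R] (s : Finset (Fin m)) (f g : Fin m → R) :
    ∏ k ∈ s, f k - ∏ k ∈ s, g k =
      ∑ i ∈ s, (f i - g i) * (∏ k ∈ s with k < i, f k) * ∏ k ∈ s with i < k, g k := by
  have := Finset.prod_sub_ordered s g fun k => g k - f k
  simp only [sub_sub_cancel] at this
  rw [this, sub_right_comm, sub_self, zero_sub, ← Finset.sum_neg_distrib]
  refine Finset.sum_congr rfl fun i _ => ?_
  ring

theorem inner_fst_zero (q : BiAffine) (w : ℂ) : q.inner (0, w) = q.zeta w := by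
  simp only [BiAffine.inner, BiAffine.zeta, BiAffine.eval, BiAffine.tilde]
  congr 1 <;> ring

theorem reproducing_fst_zero (q : BiAffine) (a b w : ℂ) :
    q.reproducing a b (0, w) = q.phi a b w := by
  simp only [BiAffine.reproducing, BiAffine.phi, BiAffine.eval, mul_div_assoc]
  congr 2; ring

theorem prod_inner_sub (h : ∀ i, (p i).Regular (l i) (t i)) (s : Finset (Fin m))
    {z : ℂ × ℂ} (hz : z ∈ bidisk) :
    ∏ k ∈ s, (p k).inner z - ∏ k ∈ s, (p k).inner (0, z.2) =
      z.1 * ∑ i ∈ s, (p i).reproducing (l i) (t i) z * (∏ k ∈ s with k < i, (p k).inner z) *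
        ((p i).phi (l i) (t i) z.2 * ∏ k ∈ s with i < k, (p k).zeta z.2) := by
  simp only [inner_fst_zero]
  rw [prod_sub_prod_ordered, Finset.mul_sum]
  refine Finset.sum_congr rfl fun i _ => ?_
  rw [(h i).inner_sub hz]
  ring

/-- Product rule for eⱼ = (θ₁ ⋯ θ_{j-1})fⱼ: the change of fⱼ gives the diagonal term ψⱼ, and the
change of the product, times φⱼ, gives the terms with i < j. -/
theorem basisValue_sub (h : ∀ i, (p i).Regular (l i) (t i)) (j : Fin m)
    {z : ℂ × ℂ} (hz : z ∈ bidisk) :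
    basisValue p l t j z - basisValue p l t j (0, z.2) =
      z.1 * ∑ i, basisValue p l t i z * backwardEntry p l t i j z.2 := by
  have h1 := prod_inner_sub h (Finset.Iio j) hz
  have h2 := (h j).reproducing_sub hz
  have h3 : ∑ i, basisValue p l t i z * backwardEntry p l t i j z.2 =
      (∑ i ∈ Finset.Iio j, (p i).reproducing (l i) (t i) z *
        (∏ k ∈ Finset.Iio j with k < i, (p k).inner z) *
        ((p i).phi (l i) (t i) z.2 * ∏ k ∈ Finset.Iio j with i < k, (p k).zeta z.2)) *
        (p j).phi (l j) (t j) z.2 + basisValue p l t j z * (p j).psi z.2 := by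
    rw [Finset.sum_mul]
    have hsub : insert j (Finset.Iio j) ⊆ Finset.univ := Finset.subset_univ _
    rw [← Finset.sum_subset hsub, Finset.sum_insert (by simp), add_comm]
    · congr 1
      · refine Finset.sum_congr rfl fun i hi => ?_
        rw [Finset.mem_Iio] at hi
        have e1 : Finset.filter (fun k => k < i) (Finset.Iio j) = Finset.Iio i := by
          ext k; simp only [Finset.mem_filter, Finset.mem_Iio]; omega
        have e2 : Finset.filter (fun k => i < k) (Finset.Iio j) = Finset.Ioo i j := by
          ext k; simp only [Finset.mem_filter, Finset.mem_Iio, Finset.mem_Ioo]; omega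
        rw [e1, e2, backwardEntry, if_pos hi, basisValue, partialProduct]
        ring
      · rw [backwardEntry, if_neg (lt_irrefl j), if_pos rfl]
    · intro i _ hi
      simp only [Finset.mem_insert, Finset.mem_Iio, not_or] at hi
      rw [backwardEntry, if_neg hi.2, if_neg (Ne.symm hi.1), mul_zero]
  rw [h3]
  simp only [basisValue, partialProduct, reproducing_fst_zero]
  linear_combination (∏ k ∈ Finset.Iio j, (p k).inner z) * h2 + (p j).phi (l j) (t j) z.2 * h1

theorem fullProduct_sub (h : ∀ i, (p i).Regular (l i) (t i)) {z : ℂ × ℂ} (hz : z ∈ bidisk) :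
    fullProduct p z - fullProduct p (0, z.2) = z.1 * ∑ i, basisValue p l t i z *
      ((p i).phi (l i) (t i) z.2 * ∏ k ∈ Finset.Ioi i, (p k).zeta z.2) := by
  rw [fullProduct, fullProduct, prod_inner_sub h _ hz]
  congr 1
  refine Finset.sum_congr rfl fun i _ => ?_
  have e1 : Finset.filter (fun k => k < i) Finset.univ = Finset.Iio i := by ext k; simp
  have e2 : Finset.filter (fun k => i < k) Finset.univ = Finset.Ioi i := by ext k; simp
  rw [e1, e2, basisValue, partialProduct]
  ring

end Products

/-! ### Functions that are rational in `z̄` -/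

/-- `h` is a rational function of `z̄` without poles on the closed unit disk. -/
def RationalInConj (h : ℂ → ℂ) : Prop :=
  ∃ P Q : Polynomial ℂ, ∀ z : ℂ, ‖z‖ ≤ 1 →
    Q.eval (conj z) ≠ 0 ∧ h z = P.eval (conj z) / Q.eval (conj z)

namespace RationalInConj

variable {h k : ℂ → ℂ}

theorem const (r : ℂ) : RationalInConj fun _ => r := ⟨.C r, 1, fun z _ => by simp⟩

theorem mul (hh : RationalInConj h) (hk : RationalInConj k) :
    RationalInConj fun z => h z * k z := by
  obtain ⟨P, Q, hPQ⟩ := hh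
  obtain ⟨P', Q', hPQ'⟩ := hk
  refine ⟨P * P', Q * Q', fun z hz => ?_⟩
  change _ ∧ h z * k z = _
  rw [Polynomial.eval_mul, Polynomial.eval_mul, (hPQ z hz).2, (hPQ' z hz).2]
  exact ⟨mul_ne_zero (hPQ z hz).1 (hPQ' z hz).1, div_mul_div_comm _ _ _ _⟩

theorem prod {ι : Type*} (s : Finset ι) {h : ι → ℂ → ℂ} (hh : ∀ i ∈ s, RationalInConj (h i)) :
    RationalInConj fun z => ∏ i ∈ s, h i z := by
  classical
  induction s using Finset.induction_on with
  | empty => simpa using const 1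
  | insert i s hi ih =>
    simpa [Finset.prod_insert hi] using (hh i (Finset.mem_insert_self i s)).mul
      (ih fun j hj => hh j (Finset.mem_insert_of_mem hj))

theorem congr (hh : RationalInConj h) (hhk : ∀ z : ℂ, ‖z‖ ≤ 1 → h z = k z) :
    RationalInConj k := by
  obtain ⟨P, Q, hPQ⟩ := hh
  exact ⟨P, Q, fun z hz => by rw [← hhk z hz]; exact hPQ z hz⟩

theorem affine_div (u v : ℂ) {a c : ℂ} (h0 : ∀ z : ℂ, ‖z‖ ≤ 1 → a + c * z ≠ 0) :
    RationalInConj fun z => conj ((u + v * z) / (a + c * z)) := by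
  refine ⟨.C (conj u) + .C (conj v) * .X, .C (conj a) + .C (conj c) * .X, fun z hz => ?_⟩
  have : conj (a + c * z) ≠ 0 := (map_ne_zero _).2 (h0 z hz)
  simp only [map_add, map_mul] at this
  simpa using this

theorem continuous_circle (hh : RationalInConj h) :
    Continuous fun x : AddCircle (1 : ℝ) => h (AddCircle.toCircle x) := by
  obtain ⟨P, Q, hPQ⟩ := hh
  have h1 : Continuous fun x : AddCircle (1 : ℝ) => (AddCircle.toCircle x : ℂ) :=
    IsMultiplication.shift.continuous
  have h2 : (fun x : AddCircle (1 : ℝ) => h (AddCircle.toCircle x)) = fun x =>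
      P.eval (conj (AddCircle.toCircle x : ℂ)) / Q.eval (conj (AddCircle.toCircle x : ℂ)) :=
    funext fun x => (hPQ _ (norm_toCircle x).le).2
  rw [h2]
  exact (P.continuous.comp (Complex.continuous_conj.comp h1)).div
    (Q.continuous.comp (Complex.continuous_conj.comp h1))
    fun x => (hPQ _ (norm_toCircle x).le).1

theorem infinite_sphere : (Metric.sphere (0 : ℂ) 1).Infinite := by
  refine (isPreconnected_sphere (by simp) (0 : ℂ) 1).infinite_of_nontrivial ?_
  exact ⟨1, by simp, -1, by simp, by norm_num⟩

theorem eq_of_eq_sphere (hh : RationalInConj h) (hk : RationalInConj k)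
    (heq : ∀ z : ℂ, ‖z‖ = 1 → h z = k z) (z : ℂ) (hz : ‖z‖ ≤ 1) : h z = k z := by
  obtain ⟨P, Q, hPQ⟩ := hh
  obtain ⟨P', Q', hPQ'⟩ := hk
  -- The cross-multiplied difference is a polynomial vanishing on the whole circle.
  have h0 : P * Q' - P' * Q = 0 := by
    refine Polynomial.eq_zero_of_infinite_isRoot _ (infinite_sphere.mono fun w hw => ?_)
    rw [mem_sphere_zero_iff_norm] at hw
    have hw' : ‖conj w‖ = 1 := by rw [RCLike.norm_conj, hw]
    have h1 := heq _ hw'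
    have h2 := hPQ _ hw'.le
    have h3 := hPQ' _ hw'.le
    rw [h2.2, h3.2, div_eq_div_iff h2.1 h3.1, Complex.conj_conj] at h1
    simp [h1]
  have h1 := congrArg (Polynomial.eval (conj z)) h0
  simp only [Polynomial.eval_sub, Polynomial.eval_mul, Polynomial.eval_zero, sub_eq_zero] at h1
  rw [(hPQ z hz).2, (hPQ' z hz).2, div_eq_div_iff (hPQ z hz).1 (hPQ' z hz).1, h1]

end RationalInConj

theorem toCircle_surjective {z : ℂ} (hz : ‖z‖ = 1) :
    ∃ x : AddCircle (1 : ℝ), (AddCircle.toCircle x : ℂ) = z := by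
  obtain ⟨x, hx⟩ := (AddCircle.homeomorphCircle (T := 1) one_ne_zero).surjective
    ⟨z, mem_sphere_zero_iff_norm.2 hz⟩
  rw [AddCircle.homeomorphCircle_apply] at hx
  exact ⟨x, congrArg (fun w : Circle => (w : ℂ)) hx⟩

/-! ### The decomposition of the model space -/

section Symbol

variable {m : ℕ} {p : Fin m → BiAffine} {l t : Fin m → ℂ}

theorem rationalInConj_explicitSymbol (h : ∀ i, (p i).Regular (l i) (t i)) (j i : Fin m) :
    RationalInConj fun z => explicitSymbol p l t z j i := by
  have hphi : ∀ i, RationalInConj fun z => conj ((p i).phi (l i) (t i) z) := fun i => by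
    refine ((RationalInConj.const (conj (l i))).mul (RationalInConj.affine_div (-(t i)) 1
      fun z hz => (h i).denom_ne_zero hz)).congr fun z _ => ?_
    rw [BiAffine.phi, map_mul, one_mul, neg_add_eq_sub]
  simp only [explicitSymbol_apply]
  by_cases h1 : i < j
  · refine (((hphi j).mul (hphi i)).mul (RationalInConj.prod (Finset.Ioo i j)
      (h := fun k z => conj ((p k).zeta z)) fun k _ => ?_)).congr fun z _ => ?_
    · refine (RationalInConj.affine_div (conj (p k).d) (conj (p k).b)
        fun z hz => (h k).denom_ne_zero hz).congr fun z _ => ?_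
      rw [BiAffine.zeta, add_comm]
    · rw [backwardEntry, if_pos h1, map_mul, map_mul, map_prod]
  · by_cases h2 : j = i
    · refine (RationalInConj.affine_div (-(p j).b) (-(p j).d)
        fun z hz => (h j).denom_ne_zero hz).congr fun z _ => ?_
      rw [backwardEntry, if_neg h1, if_pos h2, BiAffine.psi, ← neg_div, neg_add, neg_mul]
    · refine (RationalInConj.const 0).congr fun z _ => ?_
      rw [backwardEntry, if_neg h1, if_neg h2, map_zero]

variable {U : H2DiskVec m →ₗᵢ[ℂ] H2Bidisk}
  (hU : ∀ g, ∀ z ∈ bidisk, eval₂ (U g) z = ∑ i, basisValue p l t i z * eval₁ (g i) z.2)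
  (hrange : LinearMap.range U.toLinearMap = productS₂ p l t)

include hU

theorem mulZ₂_basis (g : H2DiskVec m) :
    mulZ₂ (U g) = U (WithLp.toLp 2 fun i => shift (g i)) := by
  refine eval₂_injective fun z hz => ?_
  rw [eval₂_mulZ₂ _ hz, hU _ z hz, hU _ z hz, Finset.mul_sum]
  refine Finset.sum_congr rfl fun i _ => ?_
  rw [eval₁_shift _ hz.2]
  ring

/-- S₂ is invariant under M_{z₁}*, which acts on coefficient vectors as multiplication by H;
functions of z₂ pass through the division by z₁. -/
theorem adjoint_mulZ₁_basis (h : ∀ i, (p i).Regular (l i) (t i))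
    {X : Fin m → Fin m → H2Disk →L[ℂ] H2Disk}
    (hX : ∀ i j, IsMultiplication (X i j) (backwardEntry p l t i j)) (g : H2DiskVec m) :
    ContinuousLinearMap.adjoint mulZ₁ (U g) = U (WithLp.toLp 2 fun i => ∑ j, X i j (g j)) := by
  refine adjoint_mulZ₁_eq fun z hz => ?_
  rw [hU _ z hz, hU _ _ (mem_bidisk_fst_zero hz), hU _ z hz, ← Finset.sum_sub_distrib]
  have h1 : ∀ j, basisValue p l t j z * eval₁ (g j) z.2 -
      basisValue p l t j (0, z.2) * eval₁ (g j) z.2 =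
        z.1 * ∑ i, basisValue p l t i z * (backwardEntry p l t i j z.2 * eval₁ (g j) z.2) := by
    intro j
    rw [← sub_mul, basisValue_sub h j hz, mul_assoc, Finset.sum_mul]
    simp only [mul_assoc]
  simp only [h1]
  rw [← Finset.mul_sum, Finset.sum_comm]
  congr 1
  refine Finset.sum_congr rfl fun i _ => ?_
  rw [← Finset.mul_sum, eval₁_sum _ _ hz.2]
  congr 1
  exact Finset.sum_congr rfl fun j _ => ((hX i j).eval _ _ hz.2).symm

theorem basis_inner_fullProduct (h : ∀ i, (p i).Regular (l i) (t i)) (g : H2DiskVec m)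
    {F G : H2Bidisk} (hG : ∀ z ∈ bidisk, eval₂ G z = fullProduct p z * eval₂ F z) :
    ⟪U g, G⟫_ℂ = 0 := by
  have h1 : ∀ i, ∃ f : H2Bidisk, ∀ z ∈ bidisk,
      eval₂ f z = basisValue p l t i z * eval₁ (g i) z.2 := fun i => by
    obtain ⟨T, hT⟩ := exists_isometry_prod h (Finset.Iio i)
    obtain ⟨E, hE⟩ := (h i).exists_isometry_reproducing
    refine ⟨T (E (g i)), fun z hz => ?_⟩
    rw [hT _ z hz, hE _ z hz, basisValue, partialProduct, mul_assoc]
  choose f hf using h1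
  have h2 : U g = ∑ i, f i := eval₂_injective fun z hz => by
    rw [hU g z hz, eval₂_sum _ _ hz]
    exact Finset.sum_congr rfl fun i _ => (hf i z hz).symm
  rw [h2, sum_inner]
  refine Finset.sum_eq_zero fun i _ => ?_
  obtain ⟨T, hT⟩ := exists_isometry_prod h (Finset.Ioi i)
  refine inner_basis_eq_zero h (hf i) (G' := T F) fun z hz => ?_
  rw [hG z hz, hT F z hz, fullProduct_eq p i]
  ring

/-- ΘF - Θ(0, ·)F(0, ·) = Θ(F - F(0, ·)) + (Θ - Θ(0, ·))F(0, ·). After division by z₁ the first term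
lies in ΘH², the second in S₂ by `fullProduct_sub`; `slice F 0` is F(0, ·). -/
theorem adjoint_mulZ₁_fullProduct (h : ∀ i, (p i).Regular (l i) (t i)) {F G : H2Bidisk}
    (hG : ∀ z ∈ bidisk, eval₂ G z = fullProduct p z * eval₂ F z) :
    ∃ G' ∈ mulImage (fullProduct p) ⊤, ∃ g,
      ContinuousLinearMap.adjoint mulZ₁ G = G' + U g := by
  obtain ⟨T, hT⟩ := exists_isometry_prod h Finset.univ
  have h1 : ∀ i, ∃ A, IsMultiplication A fun z =>
      (p i).phi (l i) (t i) z * ∏ k ∈ Finset.Ioi i, (p k).zeta z := fun i => by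
    obtain ⟨_, A, _, hA, -⟩ := (h i).exists_psi_phi
    obtain ⟨C, hC⟩ := IsMultiplication.exists_prod (Finset.Ioi i)
      (h := fun k => (p k).zeta) fun k _ => (h k).exists_zeta
    exact ⟨_, hA.mul hC⟩
  choose A hA using h1
  refine ⟨T (ContinuousLinearMap.adjoint mulZ₁ F),
    ⟨ContinuousLinearMap.adjoint mulZ₁ F, trivial, hT _⟩,
    WithLp.toLp 2 fun i => A i (slice F 0), adjoint_mulZ₁_eq fun z hz => ?_⟩
  have h2 := fullProduct_sub h hz
  have h3 := mul_eval₂_adjoint_mulZ₁ F hz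
  have h4 : eval₂ (U (WithLp.toLp 2 fun i => A i (slice F 0))) z =
      (∑ i, basisValue p l t i z *
        ((p i).phi (l i) (t i) z.2 * ∏ k ∈ Finset.Ioi i, (p k).zeta z.2)) *
          eval₂ F (0, z.2) := by
    rw [hU _ z hz, Finset.sum_mul]
    refine Finset.sum_congr rfl fun i _ => ?_
    change _ * eval₁ (A i (slice F 0)) z.2 = _
    rw [(hA i).eval _ _ hz.2, eval₂_fst_zero F (snd_mem_disk hz)]
    ring
  rw [eval₂_add _ _ hz, h4, hT _ z hz, hG z hz, hG _ (mem_bidisk_fst_zero hz)]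
  rw [show ∏ k, (p k).inner z = fullProduct p z from rfl]
  linear_combination eval₂ F (0, z.2) * h2 - fullProduct p z * h3

include hrange

theorem productS₂_le_modelSpace (h : ∀ i, (p i).Regular (l i) (t i)) :
    productS₂ p l t ≤ modelSpace (fullProduct p) := by
  rw [← hrange]
  rintro _ ⟨g, rfl⟩
  refine (Submodule.mem_orthogonal' _ _).2 ?_
  rintro G ⟨F, -, hG⟩
  exact basis_inner_fullProduct hU h g hG

/-- S₁ is the orthogonal complement of S₂ + ΘH². That sum is M_{z₁}*-invariant, so its complement is
M_{z₁}-invariant. -/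
theorem isZ₂Summand_productS₂ (h : ∀ i, (p i).Regular (l i) (t i)) :
    IsZ₂Summand (fullProduct p) (productS₂ p l t) := by
  choose X hX using exists_backwardEntry h
  refine ⟨Submodule.isClosed_topologicalClosure _, fun F hF => ?_,
    (productS₂ p l t)ᗮ ⊓ modelSpace (fullProduct p), ?_, ?_, ?_, ?_⟩
  · rw [← hrange] at hF ⊢
    obtain ⟨g, rfl⟩ := hF
    exact ⟨_, (mulZ₂_basis hU g).symm⟩
  · exact (Submodule.isClosed_orthogonal _).inter (Submodule.isClosed_orthogonal _)
  · rintro F ⟨hF, hF'⟩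
    rw [SetLike.mem_coe, ← hrange, Submodule.mem_orthogonal] at hF
    rw [SetLike.mem_coe, modelSpace, Submodule.mem_orthogonal] at hF'
    refine ⟨?_, ?_⟩
    · rw [SetLike.mem_coe, ← hrange, Submodule.mem_orthogonal]
      rintro _ ⟨g, rfl⟩
      rw [← ContinuousLinearMap.adjoint_inner_left]
      exact hF _ ⟨_, (adjoint_mulZ₁_basis hU h hX g).symm⟩
    · rw [SetLike.mem_coe, modelSpace, Submodule.mem_orthogonal]
      rintro G ⟨G₀, -, hG⟩
      obtain ⟨G', hG', g, hg⟩ := adjoint_mulZ₁_fullProduct hU h hG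
      rw [← ContinuousLinearMap.adjoint_inner_left, hg, inner_add_left, hF' G' hG', zero_add]
      exact hF _ ⟨g, rfl⟩
  · exact (Submodule.isOrtho_orthogonal_right (productS₂ p l t)).symm.mono_left inf_le_left
  · rw [sup_comm]
    exact Submodule.sup_orthogonal_inf_of_hasOrthogonalProjection
      (productS₂_le_modelSpace hU hrange h)

/-- U intertwines the shift on H²(𝔻)ᵐ with M_{z₂}, so the wandering subspace is the image of the
constant vectors. -/
theorem span_basis_eq_wandering :
    Submodule.span ℂ (Set.range fun i => U (PiLp.single 2 i (lp.single 2 0 (1 : ℂ)))) =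
      wandering (productS₂ p l t) := by
  refine le_antisymm (Submodule.span_le.2 ?_) ?_
  · rintro _ ⟨i, rfl⟩
    refine ⟨?_, ?_⟩
    · rw [SetLike.mem_coe, ← hrange]; exact ⟨_, rfl⟩
    · rw [SetLike.mem_coe, Submodule.mem_orthogonal']
      rintro _ ⟨F, hF, rfl⟩
      rw [SetLike.mem_coe, ← hrange] at hF
      obtain ⟨g, rfl⟩ := hF
      change ⟪U _, mulZ₂ (U g)⟫_ℂ = 0
      rw [mulZ₂_basis hU, LinearIsometry.inner_map_map, PiLp.inner_apply]
      refine Finset.sum_eq_zero fun j _ => ?_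
      rcases eq_or_ne j i with rfl | hj
      · simp [inner_single_left, shift_apply_zero]
      · simp [hj]
  · rintro F ⟨hF, hF'⟩
    rw [SetLike.mem_coe, ← hrange] at hF
    obtain ⟨g, rfl⟩ := hF
    rw [SetLike.mem_coe, Submodule.mem_orthogonal] at hF'
    -- Pairing with z₂ times the image of zⁿ in slot i reads off the coefficient of index n + 1.
    have h0 : ∀ i n, g i (n + 1) = 0 := fun i n => by
      have := hF' (mulZ₂ (U (PiLp.single 2 i (lp.single 2 n (1 : ℂ)))))
        ⟨_, by rw [SetLike.mem_coe, ← hrange]; exact ⟨_, rfl⟩, rfl⟩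
      rw [mulZ₂_basis hU] at this
      change ⟪U _, U g⟫_ℂ = 0 at this
      rw [LinearIsometry.inner_map_map, PiLp.inner_apply, Finset.sum_eq_single i] at this
      · simpa [shift_single, inner_single_left] using this
      · intro j _ hj
        simp [hj]
      · simp
    have h1 : g = ∑ i, g i 0 • PiLp.single 2 i (lp.single 2 0 (1 : ℂ)) := by
      ext j n
      simp only [WithLp.ofLp_sum, WithLp.ofLp_smul, Finset.sum_apply, Pi.smul_apply]
      rw [Finset.sum_eq_single j]
      · rcases n with _ | n
        · simp
        · simp [h0]
      · intro i _ hi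
        simp [hi.symm]
      · simp
    change U g ∈ _
    rw [h1, map_sum]
    refine Submodule.sum_mem _ fun i _ => ?_
    rw [map_smul]
    exact Submodule.smul_mem _ _ (Submodule.subset_span ⟨i, rfl⟩)

end Symbol

/-! ### The compressed shift and its symbol -/

section Unitary

variable {m : ℕ} {p : Fin m → BiAffine} {l t : Fin m → ℂ}

/-- Both projections fix F and may be moved to its side, so only M_{z₁}* acting on F remains. -/
theorem inner_compressedShift {Θ : ℂ × ℂ → ℂ} {S : Submodule ℂ H2Bidisk}
    [S.HasOrthogonalProjection] (hS : S ≤ modelSpace Θ) (F G : S) :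
    ⟪F, compressedShift Θ S G⟫_ℂ =
      ⟪ContinuousLinearMap.adjoint mulZ₁ (F : H2Bidisk), (G : H2Bidisk)⟫_ℂ := by
  rw [ContinuousLinearMap.adjoint_inner_left]
  change ⟪F, S.orthogonalProjectionOnto ((modelSpace Θ).starProjection (mulZ₁ G))⟫_ℂ = _
  rw [Submodule.inner_orthogonalProjectionOnto_eq_of_mem_left,
    ← Submodule.inner_starProjection_left_eq_right,
    Submodule.starProjection_eq_self_iff.2 (hS F.2)]

/-- The symbol of the compressed shift as a matrix over `L^∞`. -/
theorem exists_toeplitz_eq_compressedShift (h : ∀ i, (p i).Regular (l i) (t i))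
    {U : H2DiskVec m ≃ₗᵢ[ℂ] productS₂ p l t}
    (hU : ∀ g, ∀ z ∈ bidisk,
      eval₂ (U g : H2Bidisk) z = ∑ i, basisValue p l t i z * eval₁ (g i) z.2) :
    ∃ F : Matrix (Fin m) (Fin m) LInftyCircle,
      (∀ j i, F j i =ᵐ[AddCircle.haarAddCircle]
        fun x : AddCircle (1 : ℝ) => explicitSymbol p l t (AddCircle.toCircle x : ℂ) j i) ∧
      ∀ G, compressedShift (fullProduct p) (productS₂ p l t) G = U (toeplitz F (U.symm G)) := by
  choose X hX using exists_backwardEntry h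
  let V : H2DiskVec m →ₗᵢ[ℂ] H2Bidisk := (productS₂ p l t).subtypeₗᵢ.comp U.toLinearIsometry
  have hV : ∀ g, V g = U g := fun g => rfl
  have hrange : LinearMap.range V.toLinearMap = productS₂ p l t := by
    refine le_antisymm ?_ fun F hF => ⟨U.symm ⟨F, hF⟩, ?_⟩
    · rintro _ ⟨g, rfl⟩
      exact (U g).2
    · change V _ = _
      rw [hV, LinearIsometryEquiv.apply_symm_apply]
  obtain ⟨F, hF⟩ : ∃ F : Matrix (Fin m) (Fin m) LInftyCircle,
      ∀ j i, F j i =ᵐ[AddCircle.haarAddCircle]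
        fun x : AddCircle (1 : ℝ) => explicitSymbol p l t (AddCircle.toCircle x : ℂ) j i :=
    ⟨Matrix.of fun j i => ofContinuous
      ⟨_, (rationalInConj_explicitSymbol h j i).continuous_circle⟩,
      fun j i => coeFn_ofContinuous _⟩
  -- The adjoint of a block operator transposes the indices, so the entry (j, i) comes from hᵢⱼ.
  have hT : ∀ j i, toeplitzScalar (F j i) = ContinuousLinearMap.adjoint (X i j) := fun j i => by
    refine (hX i j).toeplitzScalar_eq ?_
    simpa only [explicitSymbol_apply] using hF j i
  refine ⟨F, hF, fun G => ?_⟩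
  obtain ⟨g, rfl⟩ := U.surjective G
  refine ext_inner_left ℂ fun E => ?_
  obtain ⟨u, rfl⟩ := U.surjective E
  rw [inner_compressedShift (productS₂_le_modelSpace (U := V) hU hrange h),
    LinearIsometryEquiv.symm_apply_apply, LinearIsometryEquiv.inner_map_map, ← hV, ← hV,
    adjoint_mulZ₁_basis (U := V) hU h hX, LinearIsometry.inner_map_map, PiLp.inner_apply,
    PiLp.inner_apply]
  change ∑ i, ⟪∑ j, X i j (u j), g i⟫_ℂ = ∑ j, ⟪u j, toeplitz F g j⟫_ℂ
  have h1 : ∀ i, ⟪∑ j, X i j (u j), g i⟫_ℂ = ∑ j, ⟪X i j (u j), g i⟫_ℂ := fun i => sum_inner _ _ _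
  have h2 : ∀ j, ⟪u j, toeplitz F g j⟫_ℂ = ∑ i, ⟪X i j (u j), g i⟫_ℂ := fun j => by
    rw [toeplitz_apply, inner_sum]
    refine Finset.sum_congr rfl fun i _ => ?_
    rw [hT, ContinuousLinearMap.adjoint_inner_right]
  simp only [h1, h2]
  exact Finset.sum_comm

/-- Injectivity of the symbol map gives equality almost everywhere on the circle, continuity gives
it everywhere there, and rationality in z̄ extends it to the closed disk. -/
theorem isShiftSymbol_iff (h : ∀ i, (p i).Regular (l i) (t i))
    {U : H2DiskVec m ≃ₗᵢ[ℂ] productS₂ p l t}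
    (hU : ∀ g, ∀ z ∈ bidisk,
      eval₂ (U g : H2Bidisk) z = ∑ i, basisValue p l t i z * eval₁ (g i) z.2)
    (M : ℂ → Matrix (Fin m) (Fin m) ℂ) :
    IsShiftSymbol (fullProduct p) (productS₂ p l t) U M ↔
      ∀ z : ℂ, ‖z‖ ≤ 1 → M z = explicitSymbol p l t z := by
  obtain ⟨F₀, hF₀, hF₀'⟩ := exists_toeplitz_eq_compressedShift h hU
  constructor
  · rintro ⟨hM, F, hF, hF'⟩ z hz
    have hFF : F = F₀ := toeplitz_injective <| ContinuousLinearMap.ext fun g => by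
      have := (hF' (U g)).symm.trans (hF₀' (U g))
      simpa using this
    ext j i
    refine RationalInConj.eq_of_eq_sphere (h := fun z => M z j i) (hM j i)
      (rationalInConj_explicitSymbol h j i) (fun w hw => ?_) z hz
    obtain ⟨x, rfl⟩ := toCircle_surjective hw
    have hae := (hF j i).symm.trans (hFF ▸ hF₀ j i)
    exact congrFun ((Continuous.ae_eq_iff_eq AddCircle.haarAddCircle
      (RationalInConj.continuous_circle (h := fun z => M z j i) (hM j i))
      (rationalInConj_explicitSymbol h j i).continuous_circle).1 hae) x
  · intro hM
    refine ⟨fun j i => ?_, F₀, fun j i => (hF₀ j i).trans (Eventually.of_forall fun x => ?_), hF₀'⟩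
    · exact RationalInConj.congr (rationalInConj_explicitSymbol h j i)
        (k := fun z => M z j i) fun z hz => by rw [hM z hz]
    · exact congrFun (congrFun (hM _ (norm_toCircle x).le).symm j) i

theorem exists_isBackwardShiftMatrix (h : ∀ i, (p i).Regular (l i) (t i))
    {U : H2DiskVec m →ₗᵢ[ℂ] H2Bidisk}
    (hU : ∀ g, ∀ z ∈ bidisk, eval₂ (U g) z = ∑ i, basisValue p l t i z * eval₁ (g i) z.2)
    (he : ∀ i, ∀ z ∈ bidisk, eval₂ (U (PiLp.single 2 i (lp.single 2 0 (1 : ℂ)))) z =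
      basisValue p l t i z) :
    ∃ H : Matrix (Fin m) (Fin m) H2Disk,
      (∀ H', IsBackwardShiftMatrix
        (fun i => U (PiLp.single 2 i (lp.single 2 0 (1 : ℂ)))) H' ↔ H' = H) ∧
      ∀ z ∈ disk, (H.map fun h => eval₁ h z).conjTranspose = explicitSymbol p l t z := by
  choose X hX using exists_backwardEntry h
  have hcol : ∀ j, ContinuousLinearMap.adjoint mulZ₁
      (U (PiLp.single 2 j (lp.single 2 0 (1 : ℂ)))) =
        U (WithLp.toLp 2 fun i => X i j (lp.single 2 0 (1 : ℂ))) := fun j => by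
    rw [adjoint_mulZ₁_basis hU h hX]
    congr 2
    ext1 i
    rw [Finset.sum_eq_single j]
    · simp
    · intro k _ hk
      simp [hk]
    · simp
  have hH : ∀ H', IsBackwardShiftMatrix
      (fun i => U (PiLp.single 2 i (lp.single 2 0 (1 : ℂ)))) H' ↔
        ∀ j, U (WithLp.toLp 2 fun i => X i j (lp.single 2 0 (1 : ℂ))) =
          U (WithLp.toLp 2 fun i => H' i j) := fun H' => by
    refine forall_congr' fun j => ?_
    simp only [hcol]
    have hz : ∀ z ∈ bidisk, ∑ i, eval₂ (U (PiLp.single 2 i (lp.single 2 0 (1 : ℂ)))) z *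
        eval₁ (H' i j) z.2 = eval₂ (U (WithLp.toLp 2 fun i => H' i j)) z := fun z hz => by
      rw [hU _ z hz]
      exact Finset.sum_congr rfl fun i _ => by rw [he i z hz]
    exact ⟨fun hj => eval₂_injective fun z hz' => (hj z hz').trans (hz z hz'),
      fun hj z hz' => by rw [hz z hz', hj]⟩
  -- The operator of multiplication by hᵢⱼ applied to the constant 1 is hᵢⱼ as an element of H²(𝔻);
  -- uniqueness is injectivity of U.
  refine ⟨fun i j => X i j (lp.single 2 0 (1 : ℂ)), fun H' => ?_, fun z hz => ?_⟩
  · rw [hH]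
    constructor
    · intro hj
      ext1 i j
      have := congrArg (fun g : H2DiskVec m => g i) (U.injective (hj j))
      exact this.symm
    · rintro rfl j
      rfl
  · ext j i
    rw [explicitSymbol_apply, Matrix.conjTranspose_apply]
    change conj (eval₁ (X i j (lp.single 2 0 (1 : ℂ))) z) = _
    rw [(hX i j).eval _ z hz]
    have : eval₁ (lp.single 2 0 (1 : ℂ)) z = 1 := by
      rw [eval₁, tsum_eq_single 0]
      · simp
      · intro n hn
        simp [hn]
    rw [this, mul_one]

theorem orthonormal_basis (U : H2DiskVec m →ₗᵢ[ℂ] H2Bidisk) :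
    Orthonormal ℂ fun i => U (PiLp.single 2 i (lp.single 2 0 (1 : ℂ))) := by
  rw [orthonormal_iff_ite]
  intro i j
  rw [LinearIsometry.inner_map_map, PiLp.inner_apply, Finset.sum_eq_single i]
  · rw [PiLp.single_apply, if_pos rfl, inner_single_left, PiLp.single_apply]
    rcases eq_or_ne i j with rfl | hij
    · simp
    · simp [hij]
  · intro k _ hk
    simp [hk]
  · simp

end Unitary

end BidiskModel

end

open BidiskModel in
theorem theorem4p4 (m : ℕ) (p : Fin m → BiAffine) (τ : Fin m → ℂ × ℂ) (lam : Fin m → ℂ)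
    (hp : ∀ i, (p i).IsInner)
    (hτ : ∀ i, ‖(τ i).1‖ = 1 ∧ ‖(τ i).2‖ = 1 ∧ (p i).eval (τ i) = 0)
    (hlam : ∀ i, lam i ^ 2 = conj (p i).a * (p i).c - (p i).d * conj (p i).b) :
    -- `S₂` is built from the spaces `H(fᵢ(z) conj (fᵢ(w)) / (1 - z₂ w̄₂))`
    (∀ i, IsReproducingKernelSpace ((p i).S₂ (lam i) (τ i).2) ((p i).kernel (lam i) (τ i).2)) ∧
    (Pairwise fun i j =>
      summand p lam (fun k => (τ k).2) i ⟂ summand p lam (fun k => (τ k).2) j) ∧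
    IsZ₂Summand (fullProduct p) (productS₂ p lam fun k => (τ k).2) ∧
    -- the orthonormal basis of `S₂ ⊖ z₂ S₂` and the unitary `U` belonging to it
    ∃ e : Fin m → H2Bidisk,
      (∀ i, ∀ z ∈ bidisk, eval₂ (e i) z =
        partialProduct p i z * (p i).reproducing (lam i) (τ i).2 z) ∧
      Orthonormal ℂ e ∧
      Submodule.span ℂ (Set.range e) = wandering (productS₂ p lam fun k => (τ k).2) ∧
      ∃ U : H2DiskVec m ≃ₗᵢ[ℂ] productS₂ p lam fun k => (τ k).2,
        (∀ g : H2DiskVec m, ∀ z ∈ bidisk,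
          eval₂ (U g : H2Bidisk) z = ∑ i, eval₂ (e i) z * eval₁ (g i) z.2) ∧
        -- the unique matrix `H` of the backward shift, whose adjoint is `M_Θ`
        (∃ H : Matrix (Fin m) (Fin m) H2Disk,
          (∀ H', IsBackwardShiftMatrix e H' ↔ H' = H) ∧
          ∀ z ∈ disk, (H.map fun h => eval₁ h z).conjTranspose =
            explicitSymbol p lam (fun k => (τ k).2) z) ∧
        -- `S¹_Θ = U T_M U*` holds for exactly one symbol `M` of the required kind
        ∀ M : ℂ → Matrix (Fin m) (Fin m) ℂ,
          IsShiftSymbol (fullProduct p) (productS₂ p lam fun k => (τ k).2) U M ↔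
            ∀ z : ℂ, ‖z‖ ≤ 1 → M z = explicitSymbol p lam (fun k => (τ k).2) z := by
  have h : ∀ i, (p i).Regular (lam i) ((fun k => (τ k).2) i) := fun i =>
    (hp i).regular (hτ i) (hlam i)
  obtain ⟨V, hV, hrange⟩ := exists_isometry_basis h
  -- The basis function eᵢ is the image of the constant 1 placed in slot i.
  have he : ∀ i, ∀ z ∈ bidisk, eval₂ (V (PiLp.single 2 i (lp.single 2 0 (1 : ℂ)))) z =
      basisValue p lam (fun k => (τ k).2) i z := fun i z hz => by
    rw [hV _ z hz, Finset.sum_eq_single i]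
    · have : eval₁ (lp.single 2 0 (1 : ℂ)) z.2 = 1 := by
        rw [eval₁, tsum_eq_single 0]
        · simp
        · intro n hn
          simp [hn]
      rw [PiLp.single_apply, if_pos rfl, this, mul_one]
    · intro j _ hj
      simp [hj, eval₁_zero]
    · simp
  have hmem : ∀ g, V g ∈ productS₂ p lam fun k => (τ k).2 := fun g => hrange ▸ ⟨g, rfl⟩
  let U₁ : H2DiskVec m →ₗᵢ[ℂ] productS₂ p lam fun k => (τ k).2 :=
    ⟨V.toLinearMap.codRestrict _ hmem, V.norm_map⟩
  have hsurj : Function.Surjective U₁ := by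
    rintro ⟨F, hF⟩
    rw [← hrange] at hF
    obtain ⟨g, rfl⟩ := hF
    exact ⟨g, rfl⟩
  let U := LinearIsometryEquiv.ofSurjective U₁ hsurj
  have hU : ∀ g, ∀ z ∈ bidisk, eval₂ (U g : H2Bidisk) z =
      ∑ i, basisValue p lam (fun k => (τ k).2) i z * eval₁ (g i) z.2 := hV
  refine ⟨fun i => ?_, fun i j hij => summand_isOrtho h hij,
    isZ₂Summand_productS₂ hV hrange h, _, he, orthonormal_basis V,
    span_basis_eq_wandering hV hrange, U, fun g z hz => ?_, exists_isBackwardShiftMatrix h hV he,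
    isShiftSymbol_iff h hU⟩
  · obtain ⟨E, hE⟩ := (h i).exists_isometry_reproducing
    exact (BiAffine.S₂_eq hE).2
  · rw [hU g z hz]
    exact Finset.sum_congr rfl fun i _ => by rw [he i z hz]
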